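/- Let $d\in\{1,2,3,7,11\}$, let $\mathfrak o_d\subset\mathbb C$ be the ring of integers of $\mathbb Q(\sqrt{-d})$, and let $K_d=\{z\in\mathbb C: |z|<|z-\lambda| \text{ for all } \lambda\in\mathfrak o_d\setminus\{0\}\}$. Fix any nearest-integer function $\lfloor\cdot\rceil:\mathbb C\setminus\{0\}\to\mathfrak o_d$, that is, $z-\lfloor z\rceil\in\overline{K_d}$ for all $z\neq0$. For $\beta\in K_d\setminus\mathbb Q(\sqrt{-d})$ let $a_1,a_2,\dots$ be the digits of the nearest-integer continued fraction $\beta=[0,a_1,a_2,\dots]$, i.e. $a_n=\lfloor 1/G^{n-1}(\beta)\rceil$ with $G(z)=1/z-\lfloor 1/z\rceil$. Let $\mathbf H^3=\{z+rj: z\in\mathbb C,\ r>0\}$ be hyperbolic space with the metric $(dx^2+dy^2+dr^2)/r^2$, on which $\mathrm{PSL}_2(\mathbb C)$ acts by isometries extending the Möbius transformations, let $\mathbf P_d=\mathrm{PSL}_2(\mathfrak o_d)\backslash\mathbf H^3$ be the Bianchi orbifold, and let $S=\begin{pmatrix}0&1\\-1&0\end{pmatrix}$, $T^q=\begin{pmatrix}1&q\\0&1\end{pmatrix}$.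 Let $\tilde\gamma_0(t)=\beta+e^{-t}j$ be the unit speed geodesic from $\infty$ to $\beta$ with $\tilde\gamma_0(0)=\beta+j$. Let $w_\beta(t)\in \mathrm T^1\mathbf P_d$ be the projection of its tangent vector at time $t$, and put $w_\beta=w_\beta(0)$. Write $d(w_\beta,w_\beta(t))$ for the hyperbolic distance in $\mathbf P_d$ between the base points of these vectors (the infimum of the distances between their lifts to $\mathbf H^3$). For $n\ge1$ define $\tilde\gamma_n=(T^{(-1)^{n-1}a_n}S)\circ\tilde\gamma_{n-1}$. Then for Lebesgue-almost every $\beta\in K_d$ the following holds. For every $n\ge1$ there is exactly one time $t_n\in\mathbb R$ at which $\tilde\gamma_n$ meets the unit hemisphere $\{z+rj\in\mathbf H^3:|z|^2+r^2=1\}$. Moreover, with $t_n^*=\max_{1\le i\le n}t_i$, the maximum of $e^{d(w_\beta,w_\beta(t))}$ over $t\in[0,t_n^*]$ exists for every $n\ge1$, and there is a constant $C$ (which may depend on $\beta$) such that $$\Bigl|\max_{t\in[0,t_n^*]}e^{d(w_\beta,w_\beta(t))}-\tfrac12\max_{1\le k\le n}|a_k|\Bigr|\le C\qquad\text{for all }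 n\ge1.$$ -/

import Mathlib

open scoped ComplexConjugate MatrixGroups

noncomputable section

namespace Bianchi

/-- The standard generator `ω` of the ring of integers of `ℚ(√-d)`, `d` square-free. -/
def omega (d : ℕ) : ℂ :=
  if d % 4 = 3 then (-1 + (Real.sqrt d : ℂ) * Complex.I) / 2 else (Real.sqrt d : ℂ) * Complex.I

theorem exists_omega_sq (d : ℕ) : ∃ u v : ℤ, omega d * omega d = (u : ℂ) + v * omega d := by
  have hs : (Real.sqrt d : ℂ) * (Real.sqrt d : ℂ) = (d : ℂ) := by
    rw [← Complex.ofReal_mul, Real.mul_self_sqrt (Nat.cast_nonneg d)]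
    simp
  have hI : Complex.I * Complex.I = -1 := Complex.I_mul_I
  by_cases h : d % 4 = 3
  · obtain ⟨k, hk⟩ : ∃ k : ℕ, d = 4 * k + 3 := ⟨d / 4, by omega⟩
    have hc : (d : ℂ) = 4 * k + 3 := by rw [hk]; push_cast; ring
    refine ⟨-(k + 1), -1, ?_⟩
    simp only [omega, h, if_true]
    push_cast
    linear_combination (1 / 4 : ℂ) * (Complex.I * Complex.I) * hs + (1 / 4 : ℂ) * (d : ℂ) * hI
      - (1 / 4 : ℂ) * hc
  · refine ⟨-d, 0, ?_⟩
    simp only [omega, h, if_false]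
    push_cast
    linear_combination (Complex.I * Complex.I) * hs + (d : ℂ) * hI

/-- The ring `𝔬_d = {n + m ω : n, m ∈ ℤ}`, as a subring of `ℂ`. -/
def ringO (d : ℕ) : Subring ℂ where
  carrier := {z | ∃ n m : ℤ, z = n + m * omega d}
  zero_mem' := ⟨0, 0, by simp⟩
  one_mem' := ⟨1, 0, by simp⟩
  add_mem' := by
    rintro _ _ ⟨n, m, rfl⟩ ⟨n', m', rfl⟩
    exact ⟨n + n', m + m', by push_cast; ring⟩
  neg_mem' := by
    rintro _ ⟨n, m, rfl⟩
    exact ⟨-n, -m, by push_cast; ring⟩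
  mul_mem' := by
    rintro _ _ ⟨n, m, rfl⟩ ⟨n', m', rfl⟩
    obtain ⟨u, v, h⟩ := exists_omega_sq d
    refine ⟨n * n' + m * m' * u, n * m' + m * n' + m * m' * v, ?_⟩
    push_cast
    linear_combination (m : ℂ) * m' * h

/-- The open Dirichlet domain `K_d` of `0` for the translations by `𝔬_d`. -/
def dirichletDomain (d : ℕ) : Set ℂ :=
  {z | ∀ l ∈ ringO d, l ≠ 0 → ‖z‖ < ‖z - l‖}

/-- `ch` is a nearest-integer function for `𝔬_d` (ties are broken arbitrarily). -/
def IsNearestInteger (d : ℕ) (ch : ℂ → ℂ) : Prop :=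
  ∀ z : ℂ, z ≠ 0 → ch z ∈ ringO d ∧ z - ch z ∈ closure (dirichletDomain d)

/-- The complex Gauss map `z ↦ 1/z - ⌊1/z⌉`. -/
def gaussMap (ch : ℂ → ℂ) (z : ℂ) : ℂ := 1 / z - ch (1 / z)

/-- The digits `a_0, a_1, …` of the nearest-integer continued fraction expansion of `z`. -/
def digit (ch : ℂ → ℂ) (z : ℂ) : ℕ → ℂ
  | 0 => ch z
  | n + 1 => ch (1 / (gaussMap ch)^[n] (z - ch z))

/-- Hyperbolic three-space: the points `z + r j` with `z` complex and `r > 0`. -/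
@[ext] structure H3 where
  z : ℂ
  r : ℝ
  r_pos : 0 < r

namespace H3

/-- The distance of the Riemannian metric `(dx² + dy² + dr²) / r²`
(same formula as for Mathlib's `UpperHalfPlane`). -/
def hdist (p q : H3) : ℝ :=
  2 * Real.arsinh
    (Real.sqrt (‖p.z - q.z‖ ^ 2 + (p.r - q.r) ^ 2) / (2 * Real.sqrt (p.r * q.r)))

/-- The denominator `|cz+d|² + |c|² r²` of the action. -/
def den (g : SL(2, ℂ)) (p : H3) : ℝ :=
  ‖g 1 0 * p.z + g 1 1‖ ^ 2 + ‖g 1 0‖ ^ 2 * p.r ^ 2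

theorem den_pos (g : SL(2, ℂ)) (p : H3) : 0 < den g p := by
  have hdet := g.det_coe
  rw [Matrix.det_fin_two] at hdet
  unfold den
  by_cases hc : g 1 0 = 0
  · have hd : g 1 1 ≠ 0 := by
      intro h
      rw [hc, h] at hdet
      simp at hdet
    have : 0 < ‖g 1 1‖ := norm_pos_iff.mpr hd
    simp only [hc, zero_mul, zero_add, norm_zero]
    positivity
  · have h1 : 0 < ‖g 1 0‖ := norm_pos_iff.mpr hc
    have h2 := p.r_pos
    positivity

/-- The complex coordinate of `g • p`, multiplied by `den g p`. -/
def num (g : SL(2, ℂ)) (p : H3) : ℂ :=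
  (g 0 0 * p.z + g 0 1) * conj (g 1 0 * p.z + g 1 1) + g 0 0 * conj (g 1 0) * (p.r : ℂ) ^ 2

/-- The action of `SL(2, ℂ)` on hyperbolic space extending the Möbius transformations. -/
instance : SMul SL(2, ℂ) H3 :=
  ⟨fun g p => ⟨num g p / den g p, p.r / den g p, div_pos p.r_pos (den_pos g p)⟩⟩

theorem smul_z (g : SL(2, ℂ)) (p : H3) : (g • p).z = num g p / den g p := rfl

theorem smul_r (g : SL(2, ℂ)) (p : H3) : (g • p).r = p.r / den g p := rfl

theorem den_coe (g : SL(2, ℂ)) (p : H3) :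
    (den g p : ℂ) = (g 1 0 * p.z + g 1 1) * conj (g 1 0 * p.z + g 1 1)
      + g 1 0 * conj (g 1 0) * (p.r : ℂ) ^ 2 := by
  unfold den
  rw [Complex.mul_conj', Complex.mul_conj']
  push_cast
  rfl

theorem num_mul_conj (g : SL(2, ℂ)) (p : H3) :
    num g p * conj (num g p) + (p.r : ℂ) ^ 2 = den g p *
      ((g 0 0 * p.z + g 0 1) * conj (g 0 0 * p.z + g 0 1)
        + g 0 0 * conj (g 0 0) * (p.r : ℂ) ^ 2) := by
  have hdet := g.det_coe
  rw [Matrix.det_fin_two] at hdet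
  have hdet' := congrArg conj hdet
  rw [den_coe]
  unfold num
  simp only [map_add, map_sub, map_mul, map_pow, map_one, Complex.conj_conj, Complex.conj_ofReal]
    at hdet' ⊢
  linear_combination (-(p.r : ℂ) ^ 2 * (conj (g 0 0) * conj (g 1 1) - conj (g 0 1) * conj (g 1 0)))
    * hdet - (p.r : ℂ) ^ 2 * hdet'

theorem den_mul (g h : SL(2, ℂ)) (p : H3) : den (g * h) p = den g (h • p) * den h p := by
  have hD : (den h p : ℂ) ≠ 0 := by exact_mod_cast (den_pos h p).ne'
  have key := num_mul_conj h p
  have hc := den_coe h p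
  have : (den (g * h) p : ℂ) = den g (h • p) * den h p := by
    rw [den_coe g, den_coe (g * h), smul_z, smul_r]
    simp only [map_add, map_mul, map_div₀, Complex.conj_ofReal, Complex.ofReal_div,
      Matrix.SpecialLinearGroup.coe_mul, Matrix.mul_apply, Fin.sum_univ_two]
    field_simp
    unfold num at key ⊢
    simp only [map_add, map_mul, map_pow, Complex.conj_conj, Complex.conj_ofReal] at key hc ⊢
    linear_combination (-(g 1 0 * conj (g 1 0))) * key
      - (den h p : ℂ) * (g 1 1 * conj (g 1 1)) * hc
  exact_mod_cast this

theorem num_mul (g h : SL(2, ℂ)) (p : H3) : num (g * h) p = num g (h • p) * den h p := by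
  have hD : (den h p : ℂ) ≠ 0 := by exact_mod_cast (den_pos h p).ne'
  have key := num_mul_conj h p
  have hc := den_coe h p
  unfold num at key ⊢
  rw [smul_z, smul_r]
  simp only [map_add, map_mul, map_div₀, Complex.conj_ofReal, Complex.ofReal_div,
    Matrix.SpecialLinearGroup.coe_mul, Matrix.mul_apply, Fin.sum_univ_two]
  field_simp
  unfold num
  simp only [map_add, map_mul, map_pow, Complex.conj_conj, Complex.conj_ofReal] at key hc ⊢
  linear_combination (-(g 0 0 * conj (g 1 0))) * key
    - (den h p : ℂ) * (g 0 1 * conj (g 1 1)) * hc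

instance : MulAction SL(2, ℂ) H3 where
  one_smul p := by
    have h1 : den 1 p = 1 := by simp [den]
    have h2 : num 1 p = p.z := by simp [num]
    ext1
    · rw [smul_z, h1, h2]; simp
    · rw [smul_r, h1]; simp
  mul_smul g h p := by
    have hD : (den h p : ℂ) ≠ 0 := by exact_mod_cast (den_pos h p).ne'
    ext1
    · rw [smul_z, smul_z g, num_mul, den_mul]
      push_cast
      rw [mul_div_mul_right _ _ hD]
    · rw [smul_r, smul_r g, smul_r h, den_mul, div_div, mul_comm]

/-- The unit hemisphere `H(0)` centred at the origin. -/
def unitHemisphere : Set H3 := {p | ‖p.z‖ ^ 2 + p.r ^ 2 = 1}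

end H3

/-- `SL(2, 𝔬_d)` inside `SL(2, ℂ)`. As `-I` acts trivially, its orbits on `H3` are those
of `PSL(2, 𝔬_d)`. -/
def bianchiGroup (d : ℕ) : Subgroup SL(2, ℂ) :=
  (Matrix.SpecialLinearGroup.map (n := Fin 2) (ringO d).subtype).range

/-- The Bianchi orbifold `PSL(2, 𝔬_d) \ H3`. -/
abbrev Orbifold (d : ℕ) : Type := MulAction.orbitRel.Quotient (bianchiGroup d) H3

/-- The projection of hyperbolic space onto the Bianchi orbifold. -/
def proj (d : ℕ) (p : H3) : Orbifold d := Quotient.mk _ p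

/-- The hyperbolic distance on the Bianchi orbifold: the infimum of the distances of lifts. -/
def orbifoldDist (d : ℕ) (x y : Orbifold d) : ℝ :=
  sInf {s | ∃ p q : H3, proj d p = x ∧ proj d q = y ∧ s = H3.hdist p q}

/-- The inversion `S`. -/
def matS : SL(2, ℂ) := ⟨!![0, 1; -1, 0], by simp [Matrix.det_fin_two]⟩

/-- The translation `T^q`. -/
def matT (q : ℂ) : SL(2, ℂ) := ⟨!![1, q; 0, 1], by simp [Matrix.det_fin_two]⟩

/-- The unit speed geodesic from `∞` to `β` that passes through `β + j` at time `0`. -/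
def modelGeodesic (β : ℂ) (t : ℝ) : H3 := ⟨β, Real.exp (-t), Real.exp_pos _⟩

/-- The lifts `γ_n = (T^{(-1)^{n-1} a_n} S) ∘ γ_{n-1}`, where `γ_0` is the model geodesic. -/
def liftedGeodesic (ch : ℂ → ℂ) (β : ℂ) : ℕ → ℝ → H3
  | 0, t => modelGeodesic β t
  | n + 1, t => (matT ((-1) ^ n * digit ch β (n + 1)) * matS) • liftedGeodesic ch β n t

/-- `t n`, for `n ≥ 1`, is the one and only time at which `γ_n` meets the unit hemisphere. -/
def AreIntersectionTimes (ch : ℂ → ℂ) (β : ℂ) (t : ℕ → ℝ) : Prop :=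
  ∀ n : ℕ, 1 ≤ n → ∀ s : ℝ, liftedGeodesic ch β n s ∈ H3.unitHemisphere ↔ s = t n

/-- The excursion time `t*_n = max (t_1, …, t_n)`, for `n ≥ 1`. -/
def excursionTime (t : ℕ → ℝ) (n : ℕ) : ℝ := sSup (t '' Set.Icc 1 n)

/-- The largest digit `max (|a_1|, …, |a_n|)`, for `n ≥ 1`. -/
def maxDigit (ch : ℂ → ℂ) (β : ℂ) (n : ℕ) : ℝ :=
  sSup ((fun k => ‖digit ch β k‖) '' Set.Icc 1 n)

/-- `e^{d(w_β, w_β(s))}`: the vectors `w_β` and `w_β(s)` on the orbifold have the base points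
`proj d (modelGeodesic β 0)` and `proj d (modelGeodesic β s)`. -/
def expDist (d : ℕ) (β : ℂ) (s : ℝ) : ℝ :=
  Real.exp (orbifoldDist d (proj d (modelGeodesic β 0)) (proj d (modelGeodesic β s)))

end Bianchi

end

open scoped ComplexConjugate MatrixGroups

noncomputable section

namespace Bianchi

/-! Distances are read off from heights. Every translate of `β + j` has height at most 1, so `e^d`
is at least the height of any translate of the moving point. Conversely, a translate that is not too
low can be shifted over the Dirichlet domain, and then `e^d` is at most its height plus a constant.

A group element with bottom row `(c, e)` sends the point at `x = e^{-s}` to height `x / (|cβ + e|² +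
|c|² x²)`, whose maximum over `x` is `1 / (2 |c| |cβ + e|)` when `c ≠ 0`. Up to sign, the bottom row
of the lift matrix `g_{n+1}` is the top row of `g_n`. Write `Q_n = |g_n 0 0|` for the denominator
and `θ_n = |g_n 0 0 * β + g_n 0 1|` for the error. The determinant relation gives `1 / (Q_n θ_n) =
|a_{n+1}| + O(1)`, so the excursion of `g_{n+1}` peaks at about `|a_{n+1}| / 2`. By a Legendre
criterion (`exists_convergent`) every row with small `|c| |cβ + e|` is dominated by a convergent;
the other rows stay at bounded height. The crossing times separate the excursions: until `t_n^*`
convergents of index at least `n` stay low (`height_le`), and the peak belonging to a large digit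
`a_k` comes before `t_k` (`exists_expDist_ge`).

All this needs `Q_n < Q_{n+1}`, whichever way ties are broken. That is the arithmetic core:
`BallSeparated` is a relation between `1 / g_n(∞)` and `1 / g_n(β)` that survives each step of the
algorithm (`BallSeparated.inv`, `liftMatrix_invariant`) and forces `|g_n(∞)| > 1` after every step.
"Almost every" only serves to exclude the countable field `ℚ(√-d)`. -/

/-! ### Arithmetic and norms in `𝔬_d` -/

theorem ringO_coord_of_mod {d : ℕ} (h : d % 4 = 3) {z : ℂ} (hz : z ∈ ringO d) :
    ∃ n m : ℤ, z.re = n - m / 2 ∧ z.im = m * Real.sqrt d / 2 := by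
  obtain ⟨n, m, rfl⟩ := hz
  refine ⟨n, m, ?_, ?_⟩ <;> simp [omega, h] <;> ring

theorem ringO_coord_of_not_mod {d : ℕ} (h : d % 4 ≠ 3) {z : ℂ} (hz : z ∈ ringO d) :
    ∃ n m : ℤ, z.re = n ∧ z.im = m * Real.sqrt d := by
  obtain ⟨n, m, rfl⟩ := hz
  refine ⟨n, m, ?_, ?_⟩ <;> simp [omega, h]

theorem mem_ringO_of_coord_of_mod {d : ℕ} (h : d % 4 = 3) {z : ℂ} (n m : ℤ)
    (h1 : z.re = n - m / 2) (h2 : z.im = m * Real.sqrt d / 2) : z ∈ ringO d := by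
  refine ⟨n, m, Complex.ext ?_ ?_⟩ <;> simp [omega, h, h1, h2] <;> ring

theorem mem_ringO_of_coord_of_not_mod {d : ℕ} (h : d % 4 ≠ 3) {z : ℂ} (n m : ℤ)
    (h1 : z.re = n) (h2 : z.im = m * Real.sqrt d) : z ∈ ringO d := by
  refine ⟨n, m, Complex.ext ?_ ?_⟩ <;> simp [omega, h, h1, h2]

theorem sqrt_mul_self_natCast (d : ℕ) : Real.sqrt d * Real.sqrt d = d :=
  Real.mul_self_sqrt (Nat.cast_nonneg d)

theorem conj_mem_ringO {d : ℕ} {z : ℂ} (hz : z ∈ ringO d) : conj z ∈ ringO d := by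
  by_cases h : d % 4 = 3
  · obtain ⟨n, m, h1, h2⟩ := ringO_coord_of_mod h hz
    refine mem_ringO_of_coord_of_mod h (n - m) (-m) ?_ ?_ <;> simp [h1, h2] <;> ring
  · obtain ⟨n, m, h1, h2⟩ := ringO_coord_of_not_mod h hz
    refine mem_ringO_of_coord_of_not_mod h n (-m) ?_ ?_ <;> simp [h1, h2]

theorem exists_normSq_eq {d : ℕ} {z : ℂ} (hz : z ∈ ringO d) :
    ∃ N : ℤ, Complex.normSq z = N := by
  have hs := sqrt_mul_self_natCast d
  by_cases h : d % 4 = 3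
  · obtain ⟨n, m, h1, h2⟩ := ringO_coord_of_mod h hz
    obtain ⟨k, hk⟩ : ∃ k : ℕ, d = 4 * k + 3 := ⟨d / 4, by omega⟩
    have hc : (d : ℝ) = 4 * k + 3 := by rw [hk]; push_cast; ring
    refine ⟨n ^ 2 - n * m + m ^ 2 * (k + 1), ?_⟩
    rw [Complex.normSq_apply, h1, h2]
    push_cast
    linear_combination (m : ℝ) ^ 2 / 4 * hs + (m : ℝ) ^ 2 / 4 * hc
  · obtain ⟨n, m, h1, h2⟩ := ringO_coord_of_not_mod h hz
    refine ⟨n ^ 2 + d * m ^ 2, ?_⟩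
    rw [Complex.normSq_apply, h1, h2]
    push_cast
    linear_combination (m : ℝ) ^ 2 * hs

theorem exists_two_mul_re_eq {d : ℕ} {z : ℂ} (hz : z ∈ ringO d) :
    ∃ N : ℤ, 2 * z.re = N := by
  by_cases h : d % 4 = 3
  · obtain ⟨n, m, h1, -⟩ := ringO_coord_of_mod h hz
    exact ⟨2 * n - m, by rw [h1]; push_cast; ring⟩
  · obtain ⟨n, m, h1, -⟩ := ringO_coord_of_not_mod h hz
    exact ⟨2 * n, by rw [h1]; push_cast; ring⟩

theorem one_le_normSq {d : ℕ} {z : ℂ} (hz : z ∈ ringO d) (h0 : z ≠ 0) :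
    1 ≤ Complex.normSq z := by
  obtain ⟨N, hN⟩ := exists_normSq_eq hz
  have := Complex.normSq_pos.mpr h0
  rw [hN] at this ⊢
  have h1 : 0 < N := by exact_mod_cast this
  exact_mod_cast h1

theorem one_le_norm {d : ℕ} {z : ℂ} (hz : z ∈ ringO d) (h0 : z ≠ 0) : 1 ≤ ‖z‖ := by
  have := one_le_normSq hz h0
  rw [Complex.normSq_eq_norm_sq] at this
  nlinarith [norm_nonneg z]

theorem eq_zero_of_norm_lt_one {d : ℕ} {z : ℂ} (hz : z ∈ ringO d) (h : ‖z‖ < 1) : z = 0 := by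
  by_contra h0
  exact absurd (one_le_norm hz h0) (not_le.mpr h)

theorem countable_ringO (d : ℕ) : (ringO d : Set ℂ).Countable := by
  refine (Set.countable_range (fun p : ℤ × ℤ => (p.1 : ℂ) + p.2 * omega d)).mono ?_
  rintro _ ⟨n, m, rfl⟩
  exact ⟨(n, m), rfl⟩

/-- The elements of `𝔬_d` of odd norm. -/
def IsOddElement (d : ℕ) (m : ℂ) : Prop :=
  m ∈ ringO d ∧ ∃ N : ℤ, Odd N ∧ Complex.normSq m = N

theorem IsOddElement.conj {d : ℕ} {m : ℂ} (hm : IsOddElement d m) : IsOddElement d (conj m) := by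
  obtain ⟨h1, N, h2, h3⟩ := hm
  exact ⟨conj_mem_ringO h1, N, h2, by rw [Complex.normSq_conj, h3]⟩

theorem IsOddElement.neg {d : ℕ} {m : ℂ} (hm : IsOddElement d m) : IsOddElement d (-m) := by
  obtain ⟨h1, N, h2, h3⟩ := hm
  exact ⟨neg_mem h1, N, h2, by rw [Complex.normSq_neg, h3]⟩

/-- The norm changes by `4 |l|² + 4 Re(m l̄)`, which is even because traces `2 Re` are integers.
This makes the family of half-balls invariant under translation by `𝔬_d`. -/
theorem IsOddElement.add_two_mul {d : ℕ} {m l : ℂ} (hm : IsOddElement d m) (hl : l ∈ ringO d) :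
    IsOddElement d (m + 2 * l) := by
  obtain ⟨h1, N, h2, h3⟩ := hm
  have hmem : m + 2 * l ∈ ringO d := by
    rw [two_mul]; exact add_mem h1 (add_mem hl hl)
  obtain ⟨L, hL⟩ := exists_normSq_eq hl
  obtain ⟨T, hT⟩ := exists_two_mul_re_eq (mul_mem h1 (conj_mem_ringO hl))
  refine ⟨hmem, N + 2 * (2 * L + T), h2.add_even (even_two_mul _), ?_⟩
  push_cast
  rw [← h3, ← hL, ← hT]
  simp only [Complex.normSq_apply, Complex.add_re, Complex.add_im, Complex.mul_re, Complex.mul_im,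
    Complex.conj_re, Complex.conj_im, Complex.re_ofNat, Complex.im_ofNat]
  ring

/-- Clearing denominators, 12 would be a square modulo 7. This is why `d = 7` can do without the
half-balls of `BallSeparated`. -/
theorem normSq_ne_three {l : ℂ} (hl : l ∈ ringO 7) : Complex.normSq l ≠ 3 := by
  intro h
  obtain ⟨n, m, h1, h2⟩ := ringO_coord_of_mod (by norm_num) hl
  have hs := sqrt_mul_self_natCast 7
  rw [Complex.normSq_apply, h1, h2] at h
  have h3 : (2 * n - m) ^ 2 + 7 * m ^ 2 = (12 : ℤ) := by
    have : ((2 * n - m) ^ 2 + 7 * m ^ 2 : ℝ) = 12 := by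
      push_cast at hs
      linear_combination 4 * h - (m : ℝ) ^ 2 * hs
    exact_mod_cast this
  have h4 := congrArg (Int.cast : ℤ → ZMod 7) h3
  push_cast at h4
  generalize (n : ZMod 7) = a at h4
  generalize (m : ZMod 7) = b at h4
  revert a b
  decide

/-- The norm form is obstructed modulo 4, 8 and 11 respectively. Among the fields that use
half-balls, this leaves only `d = 3` with centres of norm 7. -/
theorem normSq_ne_seven {d : ℕ} (hd : d = 1 ∨ d = 2 ∨ d = 11) {l : ℂ} (hl : l ∈ ringO d) :
    Complex.normSq l ≠ 7 := by
  intro h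
  have hs := sqrt_mul_self_natCast d
  rcases hd with rfl | rfl | rfl
  · obtain ⟨n, m, h1, h2⟩ := ringO_coord_of_not_mod (by norm_num) hl
    rw [Complex.normSq_apply, h1, h2] at h
    have h3 : n ^ 2 + m ^ 2 = (7 : ℤ) := by
      have : (n ^ 2 + m ^ 2 : ℝ) = 7 := by
        push_cast at hs h
        linear_combination h - (m : ℝ) ^ 2 * hs
      exact_mod_cast this
    have h4 := congrArg (Int.cast : ℤ → ZMod 4) h3
    push_cast at h4
    generalize (n : ZMod 4) = a at h4
    generalize (m : ZMod 4) = b at h4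
    revert a b
    decide
  · obtain ⟨n, m, h1, h2⟩ := ringO_coord_of_not_mod (by norm_num) hl
    rw [Complex.normSq_apply, h1, h2] at h
    have h3 : n ^ 2 + 2 * m ^ 2 = (7 : ℤ) := by
      have : (n ^ 2 + 2 * m ^ 2 : ℝ) = 7 := by
        push_cast at hs h
        linear_combination h - (m : ℝ) ^ 2 * hs
      exact_mod_cast this
    have h4 := congrArg (Int.cast : ℤ → ZMod 8) h3
    push_cast at h4
    generalize (n : ZMod 8) = a at h4
    generalize (m : ZMod 8) = b at h4
    revert a b
    decide
  · obtain ⟨n, m, h1, h2⟩ := ringO_coord_of_mod (by norm_num) hl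
    rw [Complex.normSq_apply, h1, h2] at h
    have h3 : (2 * n - m) ^ 2 + 11 * m ^ 2 = (28 : ℤ) := by
      have : ((2 * n - m) ^ 2 + 11 * m ^ 2 : ℝ) = 28 := by
        push_cast at hs h
        linear_combination 4 * h - (m : ℝ) ^ 2 * hs
      exact_mod_cast this
    have h4 := congrArg (Int.cast : ℤ → ZMod 11) h3
    push_cast at h4
    generalize (n : ZMod 11) = a at h4
    generalize (m : ZMod 11) = b at h4
    revert a b
    decide

/-! ### Geometry of the Dirichlet domain -/

theorem two_mul_re_mul_conj_le {d : ℕ} {z l : ℂ} (hz : z ∈ closure (dirichletDomain d))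
    (hl : l ∈ ringO d) : 2 * (z * conj l).re ≤ Complex.normSq l := by
  by_cases h0 : l = 0
  · simp [h0]
  have hle : ‖z‖ ≤ ‖z - l‖ := by
    have hcl : IsClosed {w : ℂ | ‖w‖ ≤ ‖w - l‖} :=
      isClosed_le continuous_norm (continuous_id.sub continuous_const).norm
    exact closure_minimal (fun w hw => (hw l hl h0).le) hcl hz
  have h2 : Complex.normSq z ≤ Complex.normSq (z - l) := by
    rw [Complex.normSq_eq_norm_sq, Complex.normSq_eq_norm_sq]
    gcongr
  rw [Complex.normSq_sub] at h2
  linarith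

theorem neg_mem_closure_dirichletDomain {d : ℕ} {z : ℂ}
    (hz : z ∈ closure (dirichletDomain d)) : -z ∈ closure (dirichletDomain d) := by
  refine map_mem_closure continuous_neg hz ?_
  intro w hw l hl h0
  have := hw (-l) (neg_mem hl) (neg_ne_zero.mpr h0)
  rw [norm_neg]
  rwa [← norm_neg (-w - l), show -(-w - l) = w - -l by ring]

/-- The squared circumradius is `(1 + d) / 4` for `d = 1, 2` and `(1 + d)² / (16 d)` for `d = 3, 7,
11`; the largest value is `9/11`, at `d = 11`. -/
theorem normSq_le_of_mem_closure {d : ℕ} (hd : d = 1 ∨ d = 2 ∨ d = 3 ∨ d = 7 ∨ d = 11) {z : ℂ}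
    (hz : z ∈ closure (dirichletDomain d)) : Complex.normSq z ≤ 9 / 11 := by
  have hs := sqrt_mul_self_natCast d
  have hs0 := Real.sqrt_nonneg (d : ℝ)
  have h1 := two_mul_re_mul_conj_le hz (one_mem (ringO d))
  have h1' := two_mul_re_mul_conj_le hz (neg_mem (one_mem (ringO d)))
  simp at h1 h1'
  rw [Complex.normSq_apply]
  by_cases h : d % 4 = 3
  · have key : ∀ n m : ℤ, 2 * (z.re * (n - m / 2) + z.im * (m * Real.sqrt d / 2)) ≤
        (n - m / 2) ^ 2 + d * m ^ 2 / 4 := by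
      intro n m
      have hl : (⟨n - m / 2, m * Real.sqrt d / 2⟩ : ℂ) ∈ ringO d :=
        mem_ringO_of_coord_of_mod h n m rfl rfl
      have := two_mul_re_mul_conj_le hz hl
      simp [Complex.normSq_apply] at this
      nlinarith
    -- These four elements are `(±1 ± √-d) / 2`, one for each sign pattern of the coordinates of
    -- `z`.
    have k1 := key 0 1
    have k2 := key 1 1
    have k3 := key (-1) (-1)
    have k4 := key 0 (-1)
    push_cast at k1 k2 k3 k4
    set x := |z.re| with hx
    set y := |z.im| with hy
    have hx0 : 0 ≤ x := abs_nonneg _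
    have hy0 : 0 ≤ y := abs_nonneg _
    have e1 : z.re * z.re = x * x := (abs_mul_abs_self _).symm
    have e2 : z.im * z.im = y * y := (abs_mul_abs_self _).symm
    have hx1 : x ≤ 1 / 2 := abs_le.mpr ⟨by linarith, by linarith⟩
    have hxy : x + Real.sqrt d * y ≤ (1 + d) / 4 := by
      rcases abs_cases z.re with ⟨h3, -⟩ | ⟨h3, -⟩ <;> rcases abs_cases z.im with ⟨h4, -⟩ | ⟨h4, -⟩ <;>
        rw [hx, hy, h3, h4] <;> nlinarith
    rw [e1, e2]
    have hd1 : (d : ℝ) = 3 ∨ (d : ℝ) = 7 ∨ (d : ℝ) = 11 := by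
      rcases hd with rfl | rfl | rfl | rfl | rfl <;> simp at h ⊢
    have hy2 : d * (y * y) ≤ ((1 + d) / 4 - x) ^ 2 := by
      have : 0 ≤ Real.sqrt d * y := by positivity
      calc d * (y * y) = (Real.sqrt d * y) ^ 2 := by linear_combination -(y * y) * hs
        _ ≤ _ := by gcongr; linarith
    rcases hd1 with h5 | h5 | h5 <;> rw [h5] at hy2 <;> nlinarith
  · have hl : (⟨0, Real.sqrt d⟩ : ℂ) ∈ ringO d :=
      mem_ringO_of_coord_of_not_mod h 0 1 (by simp) (by simp)
    have h2 := two_mul_re_mul_conj_le hz hl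
    have h2' := two_mul_re_mul_conj_le hz (neg_mem hl)
    simp [Complex.normSq_apply] at h2 h2'
    have hx : z.re * z.re ≤ 1 / 4 := by nlinarith
    have hd1 : (d : ℝ) = 1 ∨ (d : ℝ) = 2 := by
      rcases hd with rfl | rfl | rfl | rfl | rfl <;> simp at h ⊢
    have hs1 : 0 < Real.sqrt d := by
      apply Real.sqrt_pos.mpr
      rcases hd1 with h | h <;> rw [h] <;> norm_num
    have h3 : 2 * z.im ≤ Real.sqrt d := by nlinarith
    have h4 : -(2 * z.im) ≤ Real.sqrt d := by nlinarith
    have hy : 4 * (z.im * z.im) ≤ d := by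
      rw [← hs]; nlinarith
    rcases hd1 with h5 | h5 <;> rw [h5] at hy <;> linarith

theorem norm_le_of_mem_closure {d : ℕ} (hd : d = 1 ∨ d = 2 ∨ d = 3 ∨ d = 7 ∨ d = 11) {z : ℂ}
    (hz : z ∈ closure (dirichletDomain d)) : ‖z‖ ≤ 10 / 11 := by
  have := normSq_le_of_mem_closure hd hz
  rw [Complex.normSq_eq_norm_sq] at this
  nlinarith [norm_nonneg z]

/-! ### The ball-separation invariant -/

/-- No ball of radius `1` centred in `𝔬_d`, and (for `d ≠ 7`) no ball of radius `1/2` centred at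
half of an element of odd norm, contains `v` in its closure and `y` in its interior. -/
def BallSeparated (d : ℕ) (v y : ℂ) : Prop :=
  (∀ l ∈ ringO d, Complex.normSq (v - l) ≤ 1 → 1 ≤ Complex.normSq (y - l)) ∧
    (d ≠ 7 → ∀ m, IsOddElement d m → Complex.normSq (2 * v - m) ≤ 1 →
      1 ≤ Complex.normSq (2 * y - m))

theorem BallSeparated.const_sub {d : ℕ} {v y b : ℂ} (h : BallSeparated d v y)
    (hb : b ∈ ringO d) : BallSeparated d (b - v) (b - y) := by
  have key : ∀ x l : ℂ, Complex.normSq (b - x - l) = Complex.normSq (x - (b - l)) := by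
    intro x l
    rw [← Complex.normSq_neg]; congr 1; ring
  have key2 : ∀ x m : ℂ, Complex.normSq (2 * (b - x) - m) =
      Complex.normSq (2 * x - (-m + 2 * b)) := by
    intro x l
    rw [← Complex.normSq_neg]; congr 1; ring
  refine ⟨fun l hl => ?_, fun h7 m hm => ?_⟩
  · rw [key, key]; exact h.1 _ (sub_mem hb hl)
  · rw [key2, key2]; exact h.2 h7 _ (hm.neg.add_two_mul hb)

theorem normSq_inv_sub_mul {p : ℂ} (hp : p ≠ 0) (l k : ℂ) :
    Complex.normSq (k * p⁻¹ - l) * Complex.normSq p = Complex.normSq (k - p * l) := by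
  rw [← Complex.normSq_mul]
  congr 1
  field_simp

/-- A finite check: some unit `l` nearly aligned with the given element `c` of norm 7 has `2 Re(c
l̄) = 5`. -/
theorem exists_eisenstein_unit {n k : ℤ} (h : n ^ 2 - n * k + k ^ 2 = 7) :
    ∃ a b : ℤ, a ^ 2 - a * b + b ^ 2 = 1 ∧ 2 * n * a - n * b - k * a + 2 * k * b = 5 := by
  have hk1 : k ≤ 3 := by nlinarith [sq_nonneg (2 * n - k)]
  have hk2 : -3 ≤ k := by nlinarith [sq_nonneg (2 * n - k)]
  have hn1 : n ≤ 3 := by nlinarith [sq_nonneg (2 * k - n)]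
  have hn2 : -3 ≤ n := by nlinarith [sq_nonneg (2 * k - n)]
  interval_cases n <;> interval_cases k <;> first
    | (exfalso; revert h; decide)
    | (refine ⟨1, 0, ?_, ?_⟩ <;> decide)
    | (refine ⟨-1, 0, ?_, ?_⟩ <;> decide)
    | (refine ⟨0, 1, ?_, ?_⟩ <;> decide)
    | (refine ⟨0, -1, ?_, ?_⟩ <;> decide)
    | (refine ⟨1, 1, ?_, ?_⟩ <;> decide)
    | (refine ⟨-1, -1, ?_, ?_⟩ <;> decide)

/-- Project onto the unit `l` with `2 Re(c l̄) = 5`. The side of the hexagon facing `l` gives `2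
Re(t l̄) ≤ 1`, so `Re((3t - c) l̄) ≤ 3/2 - 5/2 = -1`. -/
theorem one_le_normSq_three_mul_sub {t c : ℂ} (ht : t ∈ closure (dirichletDomain 3))
    (hc : c ∈ ringO 3) (h7 : Complex.normSq c = 7) : 1 ≤ Complex.normSq (3 * t - c) := by
  have hs := sqrt_mul_self_natCast 3
  obtain ⟨n, k, h1, h2⟩ := ringO_coord_of_mod (by norm_num) hc
  have h3 : n ^ 2 - n * k + k ^ 2 = (7 : ℤ) := by
    have : (n ^ 2 - n * k + k ^ 2 : ℝ) = 7 := by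
      rw [← h7, Complex.normSq_apply, h1, h2]
      push_cast at hs ⊢
      linear_combination -(k : ℝ) ^ 2 / 4 * hs
    exact_mod_cast this
  obtain ⟨a, b, h4, h5⟩ := exists_eisenstein_unit h3
  have h4' : (a ^ 2 - a * b + b ^ 2 : ℝ) = 1 := by exact_mod_cast h4
  have h5' : (2 * n * a - n * b - k * a + 2 * k * b : ℝ) = 5 := by exact_mod_cast h5
  obtain ⟨l, hl⟩ : ∃ l : ℂ, l = ⟨a - b / 2, b * Real.sqrt (3 : ℕ) / 2⟩ := ⟨_, rfl⟩
  have hlre : l.re = a - b / 2 := by rw [hl]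
  have hlim : l.im = b * Real.sqrt (3 : ℕ) / 2 := by rw [hl]
  have hlO : l ∈ ringO 3 := mem_ringO_of_coord_of_mod (by norm_num) a b hlre hlim
  have hl1 : Complex.normSq l = 1 := by
    rw [Complex.normSq_apply, hlre, hlim]
    push_cast at hs ⊢
    linear_combination (b : ℝ) ^ 2 / 4 * hs + h4'
  have hcl : 2 * (c * conj l).re = 5 := by
    rw [Complex.mul_re, Complex.conj_re, Complex.conj_im, hlre, hlim, h1, h2]
    push_cast at hs ⊢
    linear_combination (k * b : ℝ) / 2 * hs + h5'
  have htl := two_mul_re_mul_conj_le ht hlO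
  rw [hl1] at htl
  have hre : ((3 * t - c) * conj l).re ≤ -1 := by
    rw [sub_mul, Complex.sub_re, mul_assoc, Complex.mul_re 3]
    simp only [Complex.re_ofNat, Complex.im_ofNat]
    linarith
  have hn : Complex.normSq ((3 * t - c) * conj l) = Complex.normSq (3 * t - c) := by
    rw [Complex.normSq_mul, Complex.normSq_conj, hl1, mul_one]
  rw [← hn, Complex.normSq_apply]
  nlinarith [mul_self_nonneg ((3 * t - c) * conj l).im]

theorem normSq_sub_conj (k : ℝ) (a b : ℂ) : Complex.normSq (k * a - conj b) =
    k ^ 2 * Complex.normSq a - 2 * k * (a * b).re + Complex.normSq b := by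
  simp [Complex.normSq_apply]
  ring

theorem normSq_ofReal_sub_mul (k : ℝ) (a b : ℂ) : Complex.normSq (k - a * b) =
    k ^ 2 - 2 * k * (a * b).re + Complex.normSq a * Complex.normSq b := by
  simp [Complex.normSq_apply]
  ring

/-- The unit ball about 0 has `t` in its interior, hence its closure cannot contain `p`. -/
theorem BallSeparated.one_lt_normSq {d : ℕ} (hd : d = 1 ∨ d = 2 ∨ d = 3 ∨ d = 7 ∨ d = 11)
    {p t : ℂ} (h : BallSeparated d p t) (ht : t ∈ closure (dirichletDomain d)) :
    1 < Complex.normSq p := by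
  by_contra hp
  have := h.1 0 (zero_mem _) (by simpa using hp)
  have h2 := normSq_le_of_mem_closure hd ht
  simp at this
  linarith

/-- Pull the offending ball back under inversion, according to the norm `N` of its centre `l` (unit
balls) or of `m` (half-balls about `m/2`). Since `|1/p| < 1`, only `N < 4`, respectively `N < 9`,
can occur. A centre of norm 1 yields a half-plane that misses the Dirichlet domain. Unit balls with
`N = 2` go to unit balls about `l̄`, and those with `N = 3` to half-balls about `l̄/2`; half-balls
with `N = 3` return to unit balls about `m̄`, and those with `N = 5` to half-balls about `m̄/2`. For
`N = 7` one gets a ball of radius `1/3` about `m̄/3`, which only matters for `d = 3` and misses the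
hexagon. -/
theorem BallSeparated.inv {d : ℕ} (hd : d = 1 ∨ d = 2 ∨ d = 3 ∨ d = 7 ∨ d = 11) {p t : ℂ}
    (h : BallSeparated d p t) (ht : t ∈ closure (dirichletDomain d)) (ht0 : t ≠ 0) :
    BallSeparated d p⁻¹ t⁻¹ := by
  have hp1 := h.one_lt_normSq hd ht
  have hp0 : p ≠ 0 := by rintro rfl; simp at hp1; linarith
  have hT := Complex.normSq_pos.mpr ht0
  have hpn : 1 < ‖p‖ := by
    rw [Complex.normSq_eq_norm_sq] at hp1
    nlinarith [norm_nonneg p]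
  have hpi : ‖p⁻¹‖ < 1 := by
    rw [norm_inv]; exact inv_lt_one_of_one_lt₀ hpn
  have hre : ∀ l ∈ ringO d, 2 * (t * l).re ≤ Complex.normSq l := by
    intro l hl
    have := two_mul_re_mul_conj_le ht (conj_mem_ringO hl)
    rwa [Complex.conj_conj, Complex.normSq_conj] at this
  have hT1 := normSq_le_of_mem_closure hd ht
  refine ⟨fun l hl hle => ?_, fun h7 m hm hle => ?_⟩
  · by_contra! hlt
    have k1 := normSq_inv_sub_mul hp0 l 1
    have k2 := normSq_inv_sub_mul ht0 l 1
    have e1 := normSq_ofReal_sub_mul 1 p l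
    have e2 := normSq_ofReal_sub_mul 1 t l
    simp only [Complex.ofReal_one] at e1 e2
    rw [one_mul, e1] at k1
    rw [one_mul, e2] at k2
    have i1 : Complex.normSq (p⁻¹ - l) * Complex.normSq p ≤ 1 * Complex.normSq p := by gcongr
    have i2 : Complex.normSq (t⁻¹ - l) * Complex.normSq t < 1 * Complex.normSq t := by gcongr
    rw [k1] at i1
    rw [k2] at i2
    have hrl := hre l hl
    obtain ⟨N, hN⟩ := exists_normSq_eq hl
    have hN0 : 0 ≤ N := by
      have := Complex.normSq_nonneg l
      rw [hN] at this; exact_mod_cast this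
    have hN4 : N < 4 := by
      by_contra! h4
      have h4' : (4 : ℝ) ≤ ‖l‖ ^ 2 := by
        rw [← Complex.normSq_eq_norm_sq, hN]; exact_mod_cast h4
      have h2 : 2 ≤ ‖l‖ := by nlinarith [norm_nonneg l]
      have h1 : ‖p⁻¹ - l‖ ≤ 1 := by
        rw [Complex.normSq_eq_norm_sq] at hle
        nlinarith [norm_nonneg (p⁻¹ - l)]
      have := norm_sub_norm_le l p⁻¹
      rw [norm_sub_rev] at this
      linarith
    rw [hN] at i1 i2 hrl
    interval_cases N <;> push_cast at hN i1 i2 hrl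
    · have : l = 0 := Complex.normSq_eq_zero.mp hN
      subst this
      simp at i2
      linarith
    · linarith
    · have f1 := normSq_sub_conj 1 p l
      have f2 := normSq_sub_conj 1 t l
      simp only [Complex.ofReal_one, one_mul] at f1 f2
      have := h.1 _ (conj_mem_ringO hl) (by rw [f1, hN]; linarith)
      rw [f2, hN] at this
      linarith
    · have h7 : d ≠ 7 := by
        rintro rfl
        exact normSq_ne_three hl hN
      have hodd : IsOddElement d l := ⟨hl, 3, by decide, by rw [hN]; norm_num⟩
      have f1 := normSq_sub_conj 2 p l
      have f2 := normSq_sub_conj 2 t l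
      simp only [Complex.ofReal_ofNat] at f1 f2
      have := h.2 h7 _ hodd.conj (by rw [f1, hN]; linarith)
      rw [f2, hN] at this
      linarith
  · by_contra! hlt
    have k1 := normSq_inv_sub_mul hp0 m 2
    have k2 := normSq_inv_sub_mul ht0 m 2
    have e1 := normSq_ofReal_sub_mul 2 p m
    have e2 := normSq_ofReal_sub_mul 2 t m
    simp only [Complex.ofReal_ofNat] at e1 e2
    rw [e1] at k1
    rw [e2] at k2
    have i1 : Complex.normSq (2 * p⁻¹ - m) * Complex.normSq p ≤ 1 * Complex.normSq p := by gcongr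
    have i2 : Complex.normSq (2 * t⁻¹ - m) * Complex.normSq t < 1 * Complex.normSq t := by gcongr
    rw [k1] at i1
    rw [k2] at i2
    have hrl := hre m hm.1
    obtain ⟨hmO, N, hodd, hN⟩ := id hm
    have hN0 : 0 ≤ N := by
      have := Complex.normSq_nonneg m
      rw [hN] at this; exact_mod_cast this
    have hN9 : N < 9 := by
      by_contra! h4
      have h4' : (9 : ℝ) ≤ ‖m‖ ^ 2 := by
        rw [← Complex.normSq_eq_norm_sq, hN]; exact_mod_cast h4
      have h2 : 3 ≤ ‖m‖ := by nlinarith [norm_nonneg m]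
      have h1 : ‖2 * p⁻¹ - m‖ ≤ 1 := by
        rw [Complex.normSq_eq_norm_sq] at hle
        nlinarith [norm_nonneg (2 * p⁻¹ - m)]
      have := norm_sub_norm_le m (2 * p⁻¹)
      rw [norm_sub_rev, norm_mul] at this
      simp only [Complex.norm_ofNat] at this
      linarith
    rw [hN] at i1 i2 hrl
    have hcases : N = 1 ∨ N = 3 ∨ N = 5 ∨ N = 7 := by
      obtain ⟨k, hk⟩ := hodd
      omega
    rcases hcases with rfl | rfl | rfl | rfl <;> push_cast at hN i1 i2 hrl
    · linarith
    · have f1 := normSq_sub_conj 1 p m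
      have f2 := normSq_sub_conj 1 t m
      simp only [Complex.ofReal_one, one_mul] at f1 f2
      have := h.1 _ (conj_mem_ringO hmO) (by rw [f1, hN]; linarith)
      rw [f2, hN] at this
      linarith
    · have f1 := normSq_sub_conj 2 p m
      have f2 := normSq_sub_conj 2 t m
      simp only [Complex.ofReal_ofNat] at f1 f2
      have := h.2 h7 _ hm.conj (by rw [f1, hN]; linarith)
      rw [f2, hN] at this
      linarith
    · have hd3 : d = 3 := by
        by_contra h3
        exact normSq_ne_seven (by tauto) hmO hN
      subst hd3
      have f2 := normSq_sub_conj 3 t m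
      simp only [Complex.ofReal_ofNat] at f2
      have := one_le_normSq_three_mul_sub ht (conj_mem_ringO hmO)
        (by rw [Complex.normSq_conj, hN])
      rw [f2, hN] at this
      linarith

/-- The start of the induction, where `g_0(∞) = ∞`. A ball of the families whose closure contains 0
has a centre given by 0 or by a unit, and for units the claim is an inequality defining the
Dirichlet domain. -/
theorem ballSeparated_zero {d : ℕ} {t : ℂ} (ht : t ∈ closure (dirichletDomain d))
    (hd : d = 1 ∨ d = 2 ∨ d = 3 ∨ d = 7 ∨ d = 11) (ht0 : t ≠ 0) :
    BallSeparated d 0 t⁻¹ := by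
  have hT := Complex.normSq_pos.mpr ht0
  have hT1 := normSq_le_of_mem_closure hd ht
  refine ⟨fun l hl hle => ?_, fun h7 m hm hle => ?_⟩
  · rw [zero_sub, Complex.normSq_neg] at hle
    have k2 := normSq_inv_sub_mul ht0 l 1
    have e2 := normSq_ofReal_sub_mul 1 t l
    simp only [Complex.ofReal_one] at e2
    rw [one_mul, e2] at k2
    refine le_of_mul_le_mul_right ?_ hT
    rw [k2]
    by_cases hl0 : l = 0
    · subst hl0
      simp
      linarith
    · have h1 := one_le_normSq hl hl0
      have h2 := two_mul_re_mul_conj_le ht (conj_mem_ringO hl)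
      rw [Complex.conj_conj, Complex.normSq_conj] at h2
      have h3 : Complex.normSq l = 1 := le_antisymm hle h1
      rw [h3] at h2 ⊢
      linarith
  · rw [mul_zero, zero_sub, Complex.normSq_neg] at hle
    obtain ⟨hmO, N, hodd, hN⟩ := hm
    have k2 := normSq_inv_sub_mul ht0 m 2
    have e2 := normSq_ofReal_sub_mul 2 t m
    simp only [Complex.ofReal_ofNat] at e2
    rw [e2] at k2
    refine le_of_mul_le_mul_right ?_ hT
    rw [k2]
    have hm0 : m ≠ 0 := by
      rintro rfl
      simp at hN
      have : N = 0 := by exact_mod_cast hN.symm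
      subst this
      exact absurd hodd (by decide)
    have h1 := one_le_normSq hmO hm0
    have h2 := two_mul_re_mul_conj_le ht (conj_mem_ringO hmO)
    rw [Complex.conj_conj, Complex.normSq_conj] at h2
    have h3 : Complex.normSq m = 1 := le_antisymm hle h1
    rw [h3] at h2 ⊢
    linarith

/-! ### Hyperbolic distance and heights -/

namespace H3

/-- The point-pair invariant `2 cosh (hdist p q) - 2`. -/
def pairInvariant (p q : H3) : ℝ := (‖p.z - q.z‖ ^ 2 + (p.r - q.r) ^ 2) / (p.r * q.r)

theorem pairInvariant_nonneg (p q : H3) : 0 ≤ pairInvariant p q := by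
  have := p.r_pos
  have := q.r_pos
  unfold pairInvariant
  positivity

theorem hdist_eq (p q : H3) : hdist p q = 2 * Real.arsinh (Real.sqrt (pairInvariant p q) / 2) := by
  have := p.r_pos
  have := q.r_pos
  unfold hdist pairInvariant
  rw [Real.sqrt_div (by positivity), div_div, mul_comm (Real.sqrt (p.r * q.r))]

/-- The mixed term needed, next to `num_mul_conj`, to see that the point-pair invariant is preserved
by the group. -/
theorem num_polarization (g : SL(2, ℂ)) (p q : H3) :
    (den g q : ℂ) * ((g 0 0 * p.z + g 0 1) * conj (g 0 0 * p.z + g 0 1)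
        + g 0 0 * conj (g 0 0) * (p.r : ℂ) ^ 2)
      + den g p * ((g 0 0 * q.z + g 0 1) * conj (g 0 0 * q.z + g 0 1)
        + g 0 0 * conj (g 0 0) * (q.r : ℂ) ^ 2)
      - num g p * conj (num g q) - conj (num g p) * num g q
      = (p.z - q.z) * conj (p.z - q.z) + (p.r : ℂ) ^ 2 + (q.r : ℂ) ^ 2 := by
  have hdet := g.det_coe
  rw [Matrix.det_fin_two] at hdet
  have hdet' := congrArg conj hdet
  rw [den_coe, den_coe]
  unfold num
  simp only [map_add, map_sub, map_mul, map_pow, map_one, Complex.conj_conj, Complex.conj_ofReal]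
    at hdet' ⊢
  linear_combination ((p.z - q.z) * (conj p.z - conj q.z) + (p.r : ℂ) ^ 2 + (q.r : ℂ) ^ 2) *
    ((conj (g 0 0) * conj (g 1 1) - conj (g 0 1) * conj (g 1 0)) * hdet + hdet')

theorem pairInvariant_smul (g : SL(2, ℂ)) (p q : H3) :
    pairInvariant (g • p) (g • q) = pairInvariant p q := by
  have hp := p.r_pos
  have hq := q.r_pos
  have dp := den_pos g p
  have dq := den_pos g q
  have hp' : (p.r : ℂ) ≠ 0 := by exact_mod_cast hp.ne'
  have hq' : (q.r : ℂ) ≠ 0 := by exact_mod_cast hq.ne'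
  have dp' : (den g p : ℂ) ≠ 0 := by exact_mod_cast dp.ne'
  have dq' : (den g q : ℂ) ≠ 0 := by exact_mod_cast dq.ne'
  have kp := num_mul_conj g p
  have kq := num_mul_conj g q
  have pol := num_polarization g p q
  have : (pairInvariant (g • p) (g • q) : ℂ) = pairInvariant p q := by
    unfold pairInvariant
    push_cast
    rw [← Complex.mul_conj', ← Complex.mul_conj']
    simp only [smul_z, smul_r]
    simp only [map_sub, map_div₀, Complex.conj_ofReal, Complex.ofReal_div] at pol ⊢
    field_simp
    linear_combination (den g q : ℂ) ^ 2 * kp + (den g p : ℂ) ^ 2 * kq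
      + (den g p : ℂ) * den g q * pol
  exact_mod_cast this

theorem hdist_smul (g : SL(2, ℂ)) (p q : H3) : hdist (g • p) (g • q) = hdist p q := by
  rw [hdist_eq, hdist_eq, pairInvariant_smul]

theorem hdist_nonneg (p q : H3) : 0 ≤ hdist p q := by
  rw [hdist_eq]
  have : 0 ≤ Real.arsinh (Real.sqrt (pairInvariant p q) / 2) :=
    Real.arsinh_nonneg_iff.mpr (by positivity)
  linarith

/-- The right-hand side is `2 cosh`, that is `e^d + e^{-d}`. -/
theorem exp_hdist_le (p q : H3) : Real.exp (hdist p q) ≤ pairInvariant p q + 2 := by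
  rw [hdist_eq, two_mul, Real.exp_add, Real.exp_arsinh]
  have hX := Real.sq_sqrt (pairInvariant_nonneg p q)
  set s := Real.sqrt (pairInvariant p q) with hs
  have h1 : Real.sqrt (1 + (s / 2) ^ 2) ^ 2 = 1 + (s / 2) ^ 2 := Real.sq_sqrt (by positivity)
  nlinarith [sq_nonneg (s / 2 - Real.sqrt (1 + (s / 2) ^ 2))]

/-- Dropping the horizontal displacement leaves the distance between two horospheres at `∞`, the
logarithm of the ratio of heights. -/
theorem r_div_r_le_exp_hdist (p q : H3) : q.r / p.r ≤ Real.exp (hdist p q) := by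
  have hp := p.r_pos
  have hq := q.r_pos
  have hqp : 0 < q.r / p.r := div_pos hq hp
  rw [← Real.log_le_iff_le_exp hqp, hdist_eq]
  have key : Real.sinh (Real.log (q.r / p.r) / 2) ≤ Real.sqrt (pairInvariant p q) / 2 := by
    have hsq : Real.sqrt (q.r / p.r) ^ 2 = q.r / p.r := Real.sq_sqrt hqp.le
    have hs0 : 0 < Real.sqrt (q.r / p.r) := Real.sqrt_pos.mpr hqp
    rw [← Real.log_sqrt hqp.le, Real.sinh_log hs0]
    apply div_le_div_of_nonneg_right _ (by norm_num)
    apply Real.le_sqrt_of_sq_le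
    have : (Real.sqrt (q.r / p.r) - (Real.sqrt (q.r / p.r))⁻¹) ^ 2
        = q.r / p.r + (q.r / p.r)⁻¹ - 2 := by
      rw [sub_sq, inv_pow, hsq, mul_assoc, mul_inv_cancel₀ hs0.ne']
      ring
    rw [this]
    unfold pairInvariant
    rw [le_div_iff₀ (by positivity)]
    have : (q.r / p.r + (q.r / p.r)⁻¹ - 2) * (p.r * q.r) = (p.r - q.r) ^ 2 := by
      field_simp
      ring
    rw [this]
    nlinarith [sq_nonneg ‖p.z - q.z‖]
  have := Real.arsinh_le_arsinh.mpr key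
  rw [Real.arsinh_sinh] at this
  linarith

end H3

/-! ### Distance on the orbifold -/

theorem proj_eq_proj_iff {d : ℕ} {p q : H3} :
    proj d p = proj d q ↔ ∃ g ∈ bianchiGroup d, g • q = p := by
  unfold proj
  rw [Quotient.eq]
  constructor
  · rintro ⟨⟨g, hg⟩, h⟩
    exact ⟨g, hg, h⟩
  · rintro ⟨g, hg, h⟩
    exact ⟨⟨g, hg⟩, h⟩

theorem orbifoldDist_proj_eq (d : ℕ) (p q : H3) :
    orbifoldDist d (proj d p) (proj d q) =
      ⨅ i : bianchiGroup d × bianchiGroup d, H3.hdist (i.1.1 • p) (i.2.1 • q) := by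
  unfold orbifoldDist iInf
  congr 1
  ext s
  constructor
  · rintro ⟨p', q', hp, hq, rfl⟩
    obtain ⟨g, hg, rfl⟩ := proj_eq_proj_iff.mp hp
    obtain ⟨h, hh, rfl⟩ := proj_eq_proj_iff.mp hq
    exact ⟨(⟨g, hg⟩, ⟨h, hh⟩), rfl⟩
  · rintro ⟨⟨g, h⟩, rfl⟩
    exact ⟨_, _, proj_eq_proj_iff.mpr ⟨g, g.2, rfl⟩, proj_eq_proj_iff.mpr ⟨h, h.2, rfl⟩, rfl⟩

theorem bddBelow_hdist (d : ℕ) (p q : H3) : BddBelow (Set.range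
    fun i : bianchiGroup d × bianchiGroup d => H3.hdist (i.1.1 • p) (i.2.1 • q)) :=
  ⟨0, by rintro _ ⟨i, rfl⟩; exact H3.hdist_nonneg _ _⟩

theorem orbifoldDist_proj_le {d : ℕ} (p q : H3) {g h : SL(2, ℂ)} (hg : g ∈ bianchiGroup d)
    (hh : h ∈ bianchiGroup d) :
    orbifoldDist d (proj d p) (proj d q) ≤ H3.hdist (g • p) (h • q) := by
  rw [orbifoldDist_proj_eq]
  exact ciInf_le (bddBelow_hdist d p q) (⟨g, hg⟩, ⟨h, hh⟩)

theorem orbifoldDist_nonneg (d : ℕ) (p q : H3) :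
    0 ≤ orbifoldDist d (proj d p) (proj d q) := by
  rw [orbifoldDist_proj_eq]
  exact le_ciInf fun i => H3.hdist_nonneg _ _

/-- For any pair of lifts, an isometry moves the second one to `k • q`; the first then still has
height at most 1, and heights bound the distance from below. -/
theorem r_smul_le_exp_orbifoldDist {d : ℕ} {p : H3} (hp : ∀ g ∈ bianchiGroup d, (g • p).r ≤ 1)
    (q : H3) {k : SL(2, ℂ)} (hk : k ∈ bianchiGroup d) :
    (k • q).r ≤ Real.exp (orbifoldDist d (proj d p) (proj d q)) := by
  rw [← Real.log_le_iff_le_exp (k • q).r_pos, orbifoldDist_proj_eq]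
  refine le_ciInf fun ⟨⟨g, hg⟩, ⟨h, hh⟩⟩ => ?_
  rw [Real.log_le_iff_le_exp (k • q).r_pos]
  dsimp only
  have h1 : H3.hdist (g • p) (h • q) = H3.hdist ((k * h⁻¹ * g) • p) (k • q) := by
    rw [← H3.hdist_smul (k * h⁻¹), smul_smul, smul_smul, inv_mul_cancel_right]
  rw [h1]
  refine le_trans ?_ (H3.r_div_r_le_exp_hdist _ _)
  rw [le_div_iff₀ (H3.r_pos _)]
  have := hp _ (mul_mem (mul_mem hk (inv_mem hh)) hg)
  nlinarith [(k • q).r_pos]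

theorem continuous_hdist_smul_modelGeodesic (p : H3) (g : SL(2, ℂ)) (β : ℂ) :
    Continuous fun s => H3.hdist p (g • modelGeodesic β s) := by
  have hr : Continuous fun s => (modelGeodesic β s).r :=
    Real.continuous_exp.comp continuous_neg
  have hd : Continuous fun s => H3.den g (modelGeodesic β s) := by
    change Continuous fun s => ‖g 1 0 * β + g 1 1‖ ^ 2 + ‖g 1 0‖ ^ 2 * Real.exp (-s) ^ 2
    fun_prop
  have hn : Continuous fun s => H3.num g (modelGeodesic β s) := by
    change Continuous fun s : ℝ => (g 0 0 * β + g 0 1) * conj (g 1 0 * β + g 1 1)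
      + g 0 0 * conj (g 1 0) * (Real.exp (-s) : ℂ) ^ 2
    fun_prop
  have hd0 : ∀ s, H3.den g (modelGeodesic β s) ≠ 0 := fun s => (H3.den_pos g _).ne'
  have hz : Continuous fun s => (g • modelGeodesic β s).z := by
    simp only [H3.smul_z]
    exact hn.div (Complex.continuous_ofReal.comp hd) fun s => by exact_mod_cast hd0 s
  have hr' : Continuous fun s => (g • modelGeodesic β s).r := by
    simp only [H3.smul_r]
    exact hr.div hd hd0
  simp only [H3.hdist_eq, H3.pairInvariant]
  refine continuous_const.mul (Real.continuous_arsinh.comp ((Continuous.sqrt ?_).div_const 2))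
  exact Continuous.div (((continuous_const.sub hz).norm.pow 2).add
    ((continuous_const.sub hr').pow 2)) (continuous_const.mul hr')
    fun s => (mul_pos p.r_pos (H3.r_pos _)).ne'

/-- An infimum of continuous functions is upper semicontinuous, which is enough for a maximum on a
compact interval. -/
theorem exists_isGreatest_expDist (d : ℕ) (β : ℂ) {T : ℝ} (hT : 0 ≤ T) :
    ∃ s ∈ Set.Icc 0 T, IsGreatest (expDist d β '' Set.Icc 0 T) (expDist d β s) := by
  have husc : UpperSemicontinuous fun s =>
      orbifoldDist d (proj d (modelGeodesic β 0)) (proj d (modelGeodesic β s)) := by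
    simp only [orbifoldDist_proj_eq]
    exact upperSemicontinuous_ciInf (fun s => bddBelow_hdist d _ _) fun i =>
      (continuous_hdist_smul_modelGeodesic _ _ β).upperSemicontinuous
  obtain ⟨s, hs, hmax⟩ := UpperSemicontinuousOn.exists_isMaxOn (s := Set.Icc 0 T)
    (Set.nonempty_Icc.mpr hT) isCompact_Icc (husc.upperSemicontinuousOn _)
  refine ⟨s, hs, Set.mem_image_of_mem _ hs, ?_⟩
  rintro _ ⟨s', hs', rfl⟩
  exact Real.exp_le_exp.mpr (hmax hs')

/-! ### Lift matrices and the Gauss map -/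

theorem apply_mem_ringO {d : ℕ} {g : SL(2, ℂ)} (hg : g ∈ bianchiGroup d) (i j : Fin 2) :
    g i j ∈ ringO d := by
  obtain ⟨h, rfl⟩ := hg
  exact (h i j).2

theorem matS_mem (d : ℕ) : matS ∈ bianchiGroup d := by
  refine ⟨⟨!![0, 1; -1, 0], by simp [Matrix.det_fin_two]⟩, ?_⟩
  ext i j
  fin_cases i <;> fin_cases j <;> rfl

theorem matT_mem {d : ℕ} {q : ℂ} (hq : q ∈ ringO d) : matT q ∈ bianchiGroup d := by
  refine ⟨⟨!![1, ⟨q, hq⟩; 0, 1], by simp [Matrix.det_fin_two]⟩, ?_⟩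
  ext i j
  fin_cases i <;> fin_cases j <;> rfl

theorem det_eq_one (g : SL(2, ℂ)) : g 0 0 * g 1 1 - g 0 1 * g 1 0 = 1 := by
  have := g.det_coe
  rwa [Matrix.det_fin_two] at this

theorem matT_mul_matS_mul_apply (b : ℂ) (g : SL(2, ℂ)) (j : Fin 2) :
    (matT b * matS * g) 0 j = -b * g 0 j + g 1 j ∧ (matT b * matS * g) 1 j = -g 0 j := by
  constructor
  · change (!![1, b; 0, 1] * !![0, 1; -1, 0] * g.1 : Matrix (Fin 2) (Fin 2) ℂ) 0 j = _
    simp [Matrix.mul_apply, Fin.sum_univ_two]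
  · change (!![1, b; 0, 1] * !![0, 1; -1, 0] * g.1 : Matrix (Fin 2) (Fin 2) ℂ) 1 j = _
    simp [Matrix.mul_apply, Fin.sum_univ_two]

/-- The matrix taking the model geodesic to the `n`-th lift. -/
def liftMatrix (ch : ℂ → ℂ) (β : ℂ) : ℕ → SL(2, ℂ)
  | 0 => 1
  | n + 1 => matT ((-1) ^ n * digit ch β (n + 1)) * matS * liftMatrix ch β n

theorem liftedGeodesic_eq (ch : ℂ → ℂ) (β : ℂ) (n : ℕ) (s : ℝ) :
    liftedGeodesic ch β n s = liftMatrix ch β n • modelGeodesic β s := by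
  induction n with
  | zero => simp [liftedGeodesic, liftMatrix]
  | succ n ih => rw [liftedGeodesic, ih, liftMatrix, mul_smul (matT _ * matS)]

/-- `β` is not a quotient of two elements of `𝔬_d`. -/
def IsIrrational (d : ℕ) (β : ℂ) : Prop :=
  ∀ q ∈ ringO d, ∀ p ∈ ringO d, q ≠ 0 → q * β + p ≠ 0

theorem IsIrrational.ne_zero {d : ℕ} {β : ℂ} (h : IsIrrational d β) : β ≠ 0 := by
  have := h 1 (one_mem _) 0 (zero_mem _) one_ne_zero
  simpa using this

theorem IsIrrational.row_ne_zero {d : ℕ} {β : ℂ} (h : IsIrrational d β) {g : SL(2, ℂ)}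
    (hg : g ∈ bianchiGroup d) (i : Fin 2) : g i 0 * β + g i 1 ≠ 0 := by
  by_cases h0 : g i 0 = 0
  · intro h1
    have hd := det_eq_one g
    rw [h0, zero_mul, zero_add] at h1
    fin_cases i
    · simp only [Fin.zero_eta] at h0 h1
      rw [h0, h1] at hd; simp at hd
    · simp only [Fin.mk_one] at h0 h1
      rw [h0, h1] at hd; simp at hd
  · exact h _ (apply_mem_ringO hg i 0) _ (apply_mem_ringO hg i 1) h0

/-- In the open domain there are no ties, so the Gauss orbit that produces the digits starts at `β`
itself. -/
theorem digit_zero_eq {d : ℕ} {ch : ℂ → ℂ} (hch : IsNearestInteger d ch) {β : ℂ}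
    (hβ : β ∈ dirichletDomain d) (h0 : β ≠ 0) : ch β = 0 := by
  obtain ⟨h1, h2⟩ := hch β h0
  by_contra hne
  have h3 := hβ (ch β) h1 hne
  have h4 := two_mul_re_mul_conj_le h2 (neg_mem h1)
  have h5 : Complex.normSq β < Complex.normSq (β - ch β) := by
    rw [Complex.normSq_eq_norm_sq, Complex.normSq_eq_norm_sq]
    gcongr
  simp [Complex.normSq_apply] at h4 h5
  linarith

theorem neg_one_pow_mul_mem_ringO {d : ℕ} {a : ℂ} (ha : a ∈ ringO d) (n : ℕ) :
    (-1) ^ n * a ∈ ringO d :=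
  mul_mem (pow_mem (neg_mem (one_mem _)) n) ha

theorem neg_one_pow_mul_mem_closure {d : ℕ} {a : ℂ} (ha : a ∈ closure (dirichletDomain d))
    (n : ℕ) : (-1) ^ n * a ∈ closure (dirichletDomain d) := by
  rcases neg_one_pow_eq_or ℂ n with h | h <;> rw [h]
  · simpa
  · simpa using neg_mem_closure_dirichletDomain ha

/-- Put `V = 1 / g(∞)` and `Y = g(β)`. The sign `(-1)^n` turns the Gauss map into `Y ↦ b - 1/Y`,
while `V ↦ 1 / (b - V)`. So a step applies `b - ·` and then inversion to the pair `(V, 1/Y)`, and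
both operations keep it ball-separated. The bound `|V| < 1` is the growth of the denominators. -/
theorem liftMatrix_invariant {d : ℕ} (hd : d = 1 ∨ d = 2 ∨ d = 3 ∨ d = 7 ∨ d = 11)
    {ch : ℂ → ℂ} (hch : IsNearestInteger d ch) {β : ℂ} (hβ : β ∈ dirichletDomain d)
    (hirr : IsIrrational d β) (n : ℕ) :
    ∃ g : SL(2, ℂ), g = liftMatrix ch β n ∧ g ∈ bianchiGroup d ∧
      (-1) ^ n * (gaussMap ch)^[n] β = (g 0 0 * β + g 0 1) / (g 1 0 * β + g 1 1) ∧
      (gaussMap ch)^[n] β ∈ closure (dirichletDomain d) ∧ g 0 0 ≠ 0 ∧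
      ‖g 1 0 / g 0 0‖ < 1 ∧
      BallSeparated d (g 1 0 / g 0 0) ((-1) ^ n * (gaussMap ch)^[n] β)⁻¹ := by
  induction n with
  | zero =>
    refine ⟨1, rfl, one_mem _, by simp, by simpa using subset_closure hβ, by simp, by simp, ?_⟩
    have := ballSeparated_zero (subset_closure hβ) hd hirr.ne_zero
    simpa using this
  | succ n ih =>
    obtain ⟨g, hgn, hg, hY, hz, hc, hV, hsep⟩ := ih
    obtain ⟨z, hzdef⟩ : ∃ z, z = (gaussMap ch)^[n] β := ⟨_, rfl⟩
    rw [← hzdef] at hY hz hsep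
    have hη := hirr.row_ne_zero hg 0
    have hζ := hirr.row_ne_zero hg 1
    have hz0 : z ≠ 0 := by
      rintro rfl
      rw [mul_zero, eq_comm, div_eq_zero_iff] at hY
      tauto
    have hdig : digit ch β (n + 1) = ch (1 / z) := by
      rw [digit, digit_zero_eq hch hβ hirr.ne_zero, sub_zero, hzdef]
    obtain ⟨ha, hz'⟩ := hch (1 / z) (one_div_ne_zero hz0)
    obtain ⟨b, hb⟩ : ∃ b, b = (-1) ^ n * ch (1 / z) := ⟨_, rfl⟩
    have hbO : b ∈ ringO d := hb ▸ neg_one_pow_mul_mem_ringO ha n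
    have hg'def : liftMatrix ch β (n + 1) = matT b * matS * g := by
      rw [liftMatrix, hdig, ← hb, hgn]
    obtain ⟨h00, h10⟩ := matT_mul_matS_mul_apply b g 0
    obtain ⟨h01, h11⟩ := matT_mul_matS_mul_apply b g 1
    have hg'mem : matT b * matS * g ∈ bianchiGroup d :=
      mul_mem (mul_mem (matT_mem hbO) (matS_mem d)) hg
    have hznext : (gaussMap ch)^[n + 1] β = 1 / z - ch (1 / z) := by
      rw [Function.iterate_succ_apply', ← hzdef, gaussMap]
    have hpow : ((-1 : ℂ) ^ n) * (-1) ^ n = 1 := by rw [← mul_pow]; simp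
    have hYinv : ((-1) ^ n * z)⁻¹ = (-1) ^ n * (1 / z) := by
      rw [mul_inv, one_div]
      congr 1
      exact inv_eq_of_mul_eq_one_left hpow
    have hYnext : (-1) ^ (n + 1) * (gaussMap ch)^[n + 1] β = b - ((-1) ^ n * z)⁻¹ := by
      rw [hznext, hYinv, hb, pow_succ]; ring
    have hsep' := hsep.const_sub hbO
    rw [← hYnext] at hsep'
    have hcl : (gaussMap ch)^[n + 1] β ∈ closure (dirichletDomain d) := hznext ▸ hz'
    have hcl' := neg_one_pow_mul_mem_closure hcl (n + 1)
    have hlt := hsep'.one_lt_normSq hd hcl'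
    have hbV : b - g 1 0 / g 0 0 ≠ 0 := by
      intro h
      rw [h] at hlt
      simp at hlt
      linarith
    have hc' : (matT b * matS * g) 0 0 ≠ 0 := by
      rw [h00]
      intro h
      apply hbV
      field_simp
      linear_combination -h
    have hVn : (matT b * matS * g) 1 0 / (matT b * matS * g) 0 0 = (b - g 1 0 / g 0 0)⁻¹ := by
      have e : -b * g 0 0 + g 1 0 = -g 0 0 * (b - g 1 0 / g 0 0) := by
        field_simp
        ring
      rw [h00, h10, e, div_mul_cancel_left₀ (neg_ne_zero.mpr hc)]
    have hYeq : (-1) ^ (n + 1) * (gaussMap ch)^[n + 1] β =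
        ((matT b * matS * g) 0 0 * β + (matT b * matS * g) 0 1) /
          ((matT b * matS * g) 1 0 * β + (matT b * matS * g) 1 1) := by
      have hζ' := hirr.row_ne_zero hg'mem 1
      rw [h10, h11] at hζ'
      rw [hYnext, hY, h00, h01, h10, h11, eq_div_iff hζ', inv_div]
      linear_combination div_mul_cancel₀ (g 1 0 * β + g 1 1) hη
    refine ⟨_, hg'def.symm, hg'mem, hYeq, hcl, hc', ?_, ?_⟩
    · rw [hVn, norm_inv]
      apply inv_lt_one_of_one_lt₀
      rw [Complex.normSq_eq_norm_sq] at hlt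
      nlinarith [norm_nonneg (b - g 1 0 / g 0 0)]
    · rw [hVn]
      refine hsep'.inv hd hcl' ?_
      rw [hYeq]
      exact div_ne_zero (hirr.row_ne_zero hg'mem 0) (hirr.row_ne_zero hg'mem 1)

/-! ### Convergents and heights along the geodesic -/

/-- The modulus of the upper left entry of `g n`. -/
def denomNorm (g : ℕ → SL(2, ℂ)) (n : ℕ) : ℝ := ‖g n 0 0‖

/-- The modulus of the linear form of the first row of `g n` at `β`. -/
def errNorm (β : ℂ) (g : ℕ → SL(2, ℂ)) (n : ℕ) : ℝ := ‖g n 0 0 * β + g n 0 1‖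

/-- Matrices of a continued fraction expansion of `β` in `𝔬_d` with increasing denominators and
geometrically decreasing errors; `b n` is the modulus of the digit number `n + 1`. -/
structure ConvergentSequence (d : ℕ) (β : ℂ) (g : ℕ → SL(2, ℂ)) (b : ℕ → ℝ) : Prop where
  mem : ∀ n, g n ∈ bianchiGroup d
  zero : g 0 = 1
  row : ∀ n j, g (n + 1) 1 j = -g n 0 j
  norm_le : ‖β‖ ≤ 10 / 11
  err_pos : ∀ n, 0 < errNorm β g n
  err_succ : ∀ n, errNorm β g (n + 1) ≤ 10 / 11 * errNorm β g n
  denom_lt : ∀ n, denomNorm g n < denomNorm g (n + 1)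
  denom_succ : ∀ n, (b n - 1) * denomNorm g n ≤ denomNorm g (n + 1)
  peak : ∀ n, |1 / (denomNorm g n * errNorm β g n) - b n| ≤ 2

/-- The value of `e^{-2t}` at the time `t` at which the `n + 1`-st lift meets the unit
hemisphere. -/
def crossingLevel (β : ℂ) (g : ℕ → SL(2, ℂ)) (n : ℕ) : ℝ :=
  (errNorm β g n ^ 2 - errNorm β g (n + 1) ^ 2) /
    (denomNorm g (n + 1) ^ 2 - denomNorm g n ^ 2)

theorem den_modelGeodesic (h : SL(2, ℂ)) (β : ℂ) (s : ℝ) : H3.den h (modelGeodesic β s) =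
    ‖h 1 0 * β + h 1 1‖ ^ 2 + ‖h 1 0‖ ^ 2 * Real.exp (-s) ^ 2 := rfl

theorem r_smul_modelGeodesic (h : SL(2, ℂ)) (β : ℂ) (s : ℝ) : (h • modelGeodesic β s).r =
    Real.exp (-s) / (‖h 1 0 * β + h 1 1‖ ^ 2 + ‖h 1 0‖ ^ 2 * Real.exp (-s) ^ 2) := rfl

theorem div_sq_add_sq_le {x y c : ℝ} (hx : 0 < x) (hy : 0 < y) (hc : 0 < c) :
    x / (y ^ 2 + c ^ 2 * x ^ 2) ≤ 1 / (2 * (c * y)) := by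
  rw [div_le_div_iff₀ (by positivity) (by positivity)]
  nlinarith [sq_nonneg (y - c * x)]

namespace ConvergentSequence

variable {d : ℕ} {β : ℂ} {g : ℕ → SL(2, ℂ)} {b : ℕ → ℝ}

theorem denom_zero (hg : ConvergentSequence d β g b) : denomNorm g 0 = 1 := by
  simp [denomNorm, hg.zero]

theorem err_zero (hg : ConvergentSequence d β g b) : errNorm β g 0 = ‖β‖ := by
  simp [errNorm, hg.zero]

theorem strictMono_denom (hg : ConvergentSequence d β g b) : StrictMono (denomNorm g) :=
  strictMono_nat_of_lt_succ hg.denom_lt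

theorem one_le_denom (hg : ConvergentSequence d β g b) (n : ℕ) : 1 ≤ denomNorm g n :=
  hg.denom_zero ▸ hg.strictMono_denom.monotone (Nat.zero_le n)

theorem err_le_pow (hg : ConvergentSequence d β g b) (n : ℕ) :
    errNorm β g n ≤ (10 / 11) ^ n := by
  induction n with
  | zero => rw [hg.err_zero, pow_zero]; linarith [hg.norm_le]
  | succ n ih => rw [pow_succ']; linarith [hg.err_succ n]

theorem err_le_one (hg : ConvergentSequence d β g b) (n : ℕ) : errNorm β g n ≤ 1 :=
  (hg.err_le_pow n).trans (pow_le_one₀ (by norm_num) (by norm_num))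

theorem exists_err_le (hg : ConvergentSequence d β g b) {δ : ℝ} (hδ : 0 < δ) :
    ∃ n, errNorm β g n ≤ δ := by
  obtain ⟨n, hn⟩ := exists_pow_lt_of_lt_one hδ (show (10 / 11 : ℝ) < 1 by norm_num)
  exact ⟨n, (hg.err_le_pow n).trans hn.le⟩

theorem determinant (hg : ConvergentSequence d β g b) (n : ℕ) :
    g n 0 0 * (g (n + 1) 0 0 * β + g (n + 1) 0 1)
      - g (n + 1) 0 0 * (g n 0 0 * β + g n 0 1) = 1 := by
  have h := det_eq_one (g (n + 1))
  rw [hg.row, hg.row] at h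
  linear_combination h

/-- By the determinant, `Q_{n+1} θ_n ≤ 1 + Q_n θ_{n+1} ≤ 1 + (10/11) Q_{n+1} θ_n`. -/
theorem denom_mul_err_le (hg : ConvergentSequence d β g b) (n : ℕ) :
    denomNorm g (n + 1) * errNorm β g n ≤ 11 := by
  have h := norm_sub_norm_le (g (n + 1) 0 0 * (g n 0 0 * β + g n 0 1))
    (g n 0 0 * (g (n + 1) 0 0 * β + g (n + 1) 0 1))
  rw [norm_sub_rev, hg.determinant n, norm_one, norm_mul, norm_mul] at h
  change denomNorm g (n + 1) * errNorm β g n - denomNorm g n * errNorm β g (n + 1) ≤ 1 at h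
  have h1 : denomNorm g n * errNorm β g (n + 1) ≤
      denomNorm g (n + 1) * (10 / 11 * errNorm β g n) :=
    mul_le_mul (hg.denom_lt n).le (hg.err_succ n) (hg.err_pos _).le
      (by linarith [hg.one_le_denom (n + 1)])
  linarith

theorem half_le_denom_mul_err (hg : ConvergentSequence d β g b) (n : ℕ) :
    1 / 2 ≤ denomNorm g (n + 1) * errNorm β g n := by
  have h := norm_sub_le (g n 0 0 * (g (n + 1) 0 0 * β + g (n + 1) 0 1))
    (g (n + 1) 0 0 * (g n 0 0 * β + g n 0 1))
  rw [hg.determinant n, norm_one, norm_mul, norm_mul] at h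
  change 1 ≤ denomNorm g n * errNorm β g (n + 1) + denomNorm g (n + 1) * errNorm β g n at h
  have h1 : denomNorm g n * errNorm β g (n + 1) ≤
      denomNorm g (n + 1) * (10 / 11 * errNorm β g n) :=
    mul_le_mul (hg.denom_lt n).le (hg.err_succ n) (hg.err_pos _).le
      (by linarith [hg.one_le_denom (n + 1)])
  linarith

/-- A Legendre type criterion: a sufficiently good approximation is a convergent. -/
theorem exists_convergent (hg : ConvergentSequence d β g b) {h : SL(2, ℂ)}
    (hh : h ∈ bianchiGroup d) (hc : h 1 0 ≠ 0)
    (hle : ‖h 1 0‖ * ‖h 1 0 * β + h 1 1‖ ≤ 1 / 50) :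
    ∃ n, denomNorm g n ≤ ‖h 1 0‖ ∧ errNorm β g n ≤ ‖h 1 0 * β + h 1 1‖ := by
  classical
  have hc1 := one_le_norm (apply_mem_ringO hh 1 0) hc
  have hc0 : 0 < ‖h 1 0‖ := by linarith
  have hex : ∃ n, ‖h 1 0‖ * errNorm β g n ≤ 1 / 2 := by
    obtain ⟨n, hn⟩ := hg.exists_err_le (show 0 < 1 / (2 * ‖h 1 0‖) by positivity)
    refine ⟨n, ?_⟩
    rw [le_div_iff₀ (by positivity)] at hn
    linarith
  -- At the first such index, minimality gives `Q_m ≤ 22 |c|`. The determinant of the two rows then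
  -- has modulus at most `1/2 + 22/50 < 1`, so it vanishes.
  obtain ⟨m, hm, hmin⟩ : ∃ m, ‖h 1 0‖ * errNorm β g m ≤ 1 / 2 ∧
      ∀ k < m, 1 / 2 < ‖h 1 0‖ * errNorm β g k :=
    ⟨Nat.find hex, Nat.find_spec hex, fun k hk => not_le.mp (Nat.find_min hex hk)⟩
  have hQ : denomNorm g m ≤ 22 * ‖h 1 0‖ := by
    cases m with
    | zero => rw [hg.denom_zero]; linarith
    | succ k =>
      have h1 := hmin k (Nat.lt_succ_self k)
      have h2 := hg.denom_mul_err_le k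
      have h3 := hg.err_pos k
      refine le_of_mul_le_mul_right ?_ h3
      linarith
  have hdet : h 1 0 * g m 0 1 - h 1 1 * g m 0 0 = 0 := by
    refine eq_zero_of_norm_lt_one (d := d) (sub_mem (mul_mem (apply_mem_ringO hh _ _)
      (apply_mem_ringO (hg.mem m) _ _)) (mul_mem (apply_mem_ringO hh _ _)
      (apply_mem_ringO (hg.mem m) _ _))) ?_
    have e : h 1 0 * g m 0 1 - h 1 1 * g m 0 0 =
        h 1 0 * (g m 0 0 * β + g m 0 1) - g m 0 0 * (h 1 0 * β + h 1 1) := by ring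
    rw [e]
    refine (norm_sub_le _ _).trans_lt ?_
    rw [norm_mul, norm_mul]
    change ‖h 1 0‖ * errNorm β g m + denomNorm g m * ‖h 1 0 * β + h 1 1‖ < 1
    have : denomNorm g m * ‖h 1 0 * β + h 1 1‖ ≤ 22 * ‖h 1 0‖ * ‖h 1 0 * β + h 1 1‖ := by
      gcongr
    linarith
  have hd := det_eq_one (g m)
  -- The rows are proportional, and unimodularity of `g m` puts the factor `u` in `𝔬_d`, hence `|u|
  -- ≥ 1`.
  obtain ⟨u, hu⟩ : ∃ u, u = h 1 0 * g m 1 1 - h 1 1 * g m 1 0 := ⟨_, rfl⟩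
  have e1 : h 1 0 = u * g m 0 0 := by
    rw [hu]; linear_combination -(h 1 0) * hd - g m 1 0 * hdet
  have e2 : h 1 1 = u * g m 0 1 := by
    rw [hu]; linear_combination -(h 1 1) * hd - g m 1 1 * hdet
  have huO : u ∈ ringO d := by
    rw [hu]
    exact sub_mem (mul_mem (apply_mem_ringO hh _ _) (apply_mem_ringO (hg.mem m) _ _))
      (mul_mem (apply_mem_ringO hh _ _) (apply_mem_ringO (hg.mem m) _ _))
  have hu0 : u ≠ 0 := by
    rintro rfl
    rw [zero_mul] at e1
    exact hc e1
  have hu1 := one_le_norm huO hu0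
  refine ⟨m, ?_, ?_⟩
  · rw [e1, norm_mul]
    exact le_mul_of_one_le_left (norm_nonneg _) hu1
  · rw [e1, e2, show u * g m 0 0 * β + u * g m 0 1 = u * (g m 0 0 * β + g m 0 1) by ring, norm_mul]
    exact le_mul_of_one_le_left (norm_nonneg _) hu1

theorem sq_lt_sq_denom (hg : ConvergentSequence d β g b) (n : ℕ) :
    denomNorm g n ^ 2 < denomNorm g (n + 1) ^ 2 := by
  have := hg.denom_lt n
  have := hg.one_le_denom n
  gcongr

/-- The constant comes from `1 - (10/11)² = 21/121 ≥ (2/5)²`. -/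
theorem crossingLevel_ge (hg : ConvergentSequence d β g b) (n : ℕ) :
    (2 / 5 * errNorm β g n / denomNorm g (n + 1)) ^ 2 ≤ crossingLevel β g n := by
  have h1 := hg.sq_lt_sq_denom n
  have h2 := hg.one_le_denom (n + 1)
  have h3 := hg.err_pos n
  have h4 := hg.err_succ n
  have h5 := hg.err_pos (n + 1)
  have h6 : errNorm β g (n + 1) ^ 2 ≤ (10 / 11 * errNorm β g n) ^ 2 := by gcongr
  unfold crossingLevel
  rw [div_pow]
  apply div_le_div₀
  · nlinarith [sq_nonneg (errNorm β g n)]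
  · nlinarith [sq_nonneg (errNorm β g n)]
  · linarith
  · nlinarith [sq_nonneg (denomNorm g n)]

theorem crossingLevel_pos (hg : ConvergentSequence d β g b) (n : ℕ) :
    0 < crossingLevel β g n := by
  have h2 := hg.one_le_denom (n + 1)
  have h3 := hg.err_pos n
  exact lt_of_lt_of_le (by positivity) (hg.crossingLevel_ge n)

theorem height_le (hg : ConvergentSequence d β g b) {h : SL(2, ℂ)} (hh : h ∈ bianchiGroup d)
    {s : ℝ} (hs : 0 ≤ s) {m n : ℕ} (hmn : m < n)
    (hsm : crossingLevel β g m ≤ Real.exp (-s) ^ 2) {B : ℝ} (hB0 : 0 ≤ B)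
    (hB : ∀ k < n, b k ≤ B) : (h • modelGeodesic β s).r ≤ 1 / 2 * B + 25 := by
  rw [r_smul_modelGeodesic]
  have hx := Real.exp_pos (-s)
  have hx1 : Real.exp (-s) ≤ 1 := Real.exp_le_one_iff.mpr (by linarith)
  set x := Real.exp (-s) with hxdef
  by_cases hc : h 1 0 = 0
  · have hd := det_eq_one h
    have hd0 : h 1 1 ≠ 0 := by
      intro h0
      rw [hc, h0] at hd
      simp at hd
    have h1 := one_le_norm (apply_mem_ringO hh 1 1) hd0
    rw [hc]
    simp only [zero_mul, zero_add, norm_zero]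
    have : x / (‖h 1 1‖ ^ 2 + 0 ^ 2 * x ^ 2) ≤ 1 := by
      rw [div_le_one (by positivity)]
      nlinarith
    linarith
  have hc1 := one_le_norm (apply_mem_ringO hh 1 0) hc
  have hc0 : 0 < ‖h 1 0‖ := by linarith
  -- Poor approximations reach height at most `1 / (2/50) = 25`.
  rcases lt_or_ge (1 / 50) (‖h 1 0‖ * ‖h 1 0 * β + h 1 1‖) with hlt | hle
  · have hy : 0 < ‖h 1 0 * β + h 1 1‖ := by
      by_contra! h0
      nlinarith
    refine (div_sq_add_sq_le hx hy hc0).trans ?_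
    rw [div_le_iff₀ (by positivity)]
    nlinarith
  obtain ⟨k, hk1, hk2⟩ := hg.exists_convergent hh hc hle
  have hQ := hg.one_le_denom k
  have hQ0 : 0 < denomNorm g k := by linarith
  have hθ := hg.err_pos k
  have hxk : x / (‖h 1 0 * β + h 1 1‖ ^ 2 + ‖h 1 0‖ ^ 2 * x ^ 2) ≤
      x / (errNorm β g k ^ 2 + denomNorm g k ^ 2 * x ^ 2) := by gcongr
  refine hxk.trans ?_
  rcases lt_or_ge k n with hkn | hkn
  · have h1 := div_sq_add_sq_le hx hθ hQ0
    have h2 := (abs_le.mp (hg.peak k)).2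
    have h3 := hB k hkn
    have h4 : 1 / (2 * (denomNorm g k * errNorm β g k)) =
        1 / 2 * (1 / (denomNorm g k * errNorm β g k)) := by
      field_simp
    linarith
  -- A convergent of index `k > m` has not yet risen before the crossing time of index `m`: there
  -- `Q_k² x ≥ (2/5) Q_{m+1} θ_m ≥ 1/5`, so the height is at most `1 / (Q_k² x) ≤ 5`.
  · have hθm := hg.err_pos m
    have hQm := hg.one_le_denom (m + 1)
    have h1 : 2 / 5 * errNorm β g m / denomNorm g (m + 1) ≤ x := by
      have := (hg.crossingLevel_ge m).trans hsm
      exact le_of_sq_le_sq this hx.le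
    have h2 : denomNorm g (m + 1) ≤ denomNorm g k :=
      hg.strictMono_denom.monotone (by omega)
    have h3 := hg.half_le_denom_mul_err m
    rw [div_le_iff₀ (by linarith)] at h1
    have h4 : 1 / 5 ≤ denomNorm g k ^ 2 * x := by
      have h5 : denomNorm g (m + 1) * (2 / 5 * errNorm β g m) ≤
          denomNorm g (m + 1) * (x * denomNorm g (m + 1)) := by gcongr
      have h6 : denomNorm g (m + 1) ^ 2 * x ≤ denomNorm g k ^ 2 * x := by gcongr
      nlinarith
    have h7 : x / (errNorm β g k ^ 2 + denomNorm g k ^ 2 * x ^ 2) ≤ 5 := by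
      rw [div_le_iff₀ (by positivity)]
      nlinarith [sq_nonneg (errNorm β g k)]
    linarith

/-- Take the first `m` with `θ_m² ≤ x`. Then `Q_m² x ≤ 11²`, so the denominator of the height is at
most `x + 121 x`. -/
theorem exists_height_ge (hg : ConvergentSequence d β g b) {s : ℝ} (hs : 0 ≤ s) :
    ∃ h ∈ bianchiGroup d, 1 / 122 ≤ (h • modelGeodesic β s).r := by
  classical
  have hx := Real.exp_pos (-s)
  have hx1 : Real.exp (-s) ≤ 1 := Real.exp_le_one_iff.mpr (by linarith)
  have hex : ∃ n, errNorm β g n ^ 2 ≤ Real.exp (-s) := by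
    obtain ⟨n, hn⟩ := hg.exists_err_le hx
    have := hg.err_pos n
    exact ⟨n, by nlinarith⟩
  obtain ⟨m, hm, hmin⟩ : ∃ m, errNorm β g m ^ 2 ≤ Real.exp (-s) ∧
      ∀ k < m, Real.exp (-s) < errNorm β g k ^ 2 :=
    ⟨Nat.find hex, Nat.find_spec hex, fun k hk => not_le.mp (Nat.find_min hex hk)⟩
  refine ⟨g (m + 1), hg.mem _, ?_⟩
  rw [r_smul_modelGeodesic, hg.row, hg.row, neg_mul, ← neg_add, norm_neg, norm_neg]
  change _ ≤ Real.exp (-s) / (errNorm β g m ^ 2 + denomNorm g m ^ 2 * Real.exp (-s) ^ 2)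
  set x := Real.exp (-s) with hxdef
  have hθ := hg.err_pos m
  have hQ := hg.one_le_denom m
  have key : denomNorm g m ^ 2 * x ≤ 121 := by
    cases m with
    | zero => rw [hg.denom_zero]; linarith
    | succ k =>
      have h1 := hmin k (Nat.lt_succ_self k)
      have h2 := hg.denom_mul_err_le k
      have h3 := hg.err_pos k
      have h4 : denomNorm g (k + 1) ^ 2 * x ≤ denomNorm g (k + 1) ^ 2 * errNorm β g k ^ 2 := by
        gcongr
      have h5 : (denomNorm g (k + 1) * errNorm β g k) ^ 2 ≤ 11 ^ 2 := by gcongr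
      linarith
  rw [le_div_iff₀ (by positivity)]
  nlinarith

end ConvergentSequence

/-! ### Comparing orbifold distance with height -/

theorem r_smul_modelGeodesic_zero_le {d : ℕ} {h : SL(2, ℂ)} (hh : h ∈ bianchiGroup d) (β : ℂ) :
    (h • modelGeodesic β 0).r ≤ 1 := by
  rw [r_smul_modelGeodesic, neg_zero, Real.exp_zero]
  have key : 1 ≤ ‖h 1 0 * β + h 1 1‖ ^ 2 + ‖h 1 0‖ ^ 2 * 1 ^ 2 := by
    by_cases hc : h 1 0 = 0
    · have hd := det_eq_one h
      have hd0 : h 1 1 ≠ 0 := by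
        intro h0
        rw [hc, h0] at hd
        simp at hd
      have h1 := one_le_norm (apply_mem_ringO hh 1 1) hd0
      rw [hc]
      simp only [zero_mul, zero_add, norm_zero]
      nlinarith
    · have h1 := one_le_norm (apply_mem_ringO hh 1 0) hc
      nlinarith [sq_nonneg ‖h 1 0 * β + h 1 1‖]
  rw [div_le_one (by linarith)]
  exact key

theorem r_le_expDist {d : ℕ} {h : SL(2, ℂ)} (hh : h ∈ bianchiGroup d) (β : ℂ) (s : ℝ) :
    (h • modelGeodesic β s).r ≤ expDist d β s :=
  r_smul_le_exp_orbifoldDist (fun _ hg => r_smul_modelGeodesic_zero_le hg β) _ hh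

theorem one_le_expDist (d : ℕ) (β : ℂ) (s : ℝ) : 1 ≤ expDist d β s :=
  Real.one_le_exp (orbifoldDist_nonneg d _ _)

theorem matT_smul (q : ℂ) (p : H3) : (matT q • p).z = p.z + q ∧ (matT q • p).r = p.r := by
  have hd : H3.den (matT q) p = 1 := by simp [H3.den, matT]
  have hn : H3.num (matT q) p = p.z + q := by simp [H3.num, matT]
  constructor
  · rw [H3.smul_z, hd, hn]; simp
  · rw [H3.smul_r, hd, div_one]

theorem expDist_le {d : ℕ} (hd : d = 1 ∨ d = 2 ∨ d = 3 ∨ d = 7 ∨ d = 11)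
    {ch : ℂ → ℂ} (hch : IsNearestInteger d ch) {β : ℂ} (hβ : ‖β‖ ≤ 1) {s : ℝ} {h : SL(2, ℂ)}
    (hh : h ∈ bianchiGroup d) (hr : 1 / 122 ≤ (h • modelGeodesic β s).r) :
    expDist d β s ≤ (h • modelGeodesic β s).r + 612 := by
  obtain ⟨k, hk, hkr, hkz⟩ : ∃ k ∈ bianchiGroup d,
      (k • modelGeodesic β s).r = (h • modelGeodesic β s).r ∧ ‖(k • modelGeodesic β s).z‖ ≤ 1 := by
    by_cases hz : (h • modelGeodesic β s).z = 0
    · exact ⟨h, hh, rfl, by rw [hz]; simp⟩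
    · obtain ⟨h1, h2⟩ := hch _ hz
      obtain ⟨e1, e2⟩ := matT_smul (-ch (h • modelGeodesic β s).z) (h • modelGeodesic β s)
      refine ⟨matT (-ch (h • modelGeodesic β s).z) * h, mul_mem (matT_mem (neg_mem h1)) hh, ?_, ?_⟩
      · rw [mul_smul, e2]
      · rw [mul_smul, e1, ← sub_eq_add_neg]
        exact (norm_le_of_mem_closure hd h2).trans (by norm_num)
  have h1 : expDist d β s ≤ H3.pairInvariant (modelGeodesic β 0) (k • modelGeodesic β s) + 2 := by
    refine le_trans (Real.exp_le_exp.mpr ?_) (H3.exp_hdist_le _ _)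
    simpa using orbifoldDist_proj_le (modelGeodesic β 0) (modelGeodesic β s) (one_mem _) hk
  refine h1.trans ?_
  rw [← hkr] at hr ⊢
  set q := k • modelGeodesic β s
  have hn : ‖β - q.z‖ ^ 2 ≤ 2 ^ 2 := by
    have := norm_sub_le β q.z
    gcongr
    linarith
  -- The invariant is at most `(4 + (1 - r)²) / r ≤ r + 5/r`, and `5 · 122 = 610`.
  have hX : H3.pairInvariant (modelGeodesic β 0) q ≤ q.r + 610 := by
    unfold H3.pairInvariant
    have e1 : (modelGeodesic β 0).z = β := rfl
    have e2 : (modelGeodesic β 0).r = 1 := by simp [modelGeodesic]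
    rw [e1, e2, div_le_iff₀ (by linarith)]
    nlinarith
  linarith

/-! ### Crossings of the unit hemisphere and the lower bound -/

theorem norm_num_sq_add (g : SL(2, ℂ)) (p : H3) : ‖H3.num g p‖ ^ 2 + p.r ^ 2 =
    H3.den g p * (‖g 0 0 * p.z + g 0 1‖ ^ 2 + ‖g 0 0‖ ^ 2 * p.r ^ 2) := by
  have h := H3.num_mul_conj g p
  rw [Complex.mul_conj', Complex.mul_conj', Complex.mul_conj'] at h
  exact_mod_cast h

theorem smul_mem_unitHemisphere_iff (g : SL(2, ℂ)) (p : H3) : g • p ∈ H3.unitHemisphere ↔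
    ‖g 0 0 * p.z + g 0 1‖ ^ 2 + ‖g 0 0‖ ^ 2 * p.r ^ 2 = H3.den g p := by
  have hD := H3.den_pos g p
  have key : ‖(g • p).z‖ ^ 2 + (g • p).r ^ 2 =
      (‖g 0 0 * p.z + g 0 1‖ ^ 2 + ‖g 0 0‖ ^ 2 * p.r ^ 2) / H3.den g p := by
    rw [H3.smul_z, H3.smul_r, norm_div, Complex.norm_real, Real.norm_of_nonneg hD.le, div_pow,
      div_pow, ← add_div, norm_num_sq_add]
    field_simp
  change ‖(g • p).z‖ ^ 2 + (g • p).r ^ 2 = 1 ↔ _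
  rw [key, div_eq_one_iff_eq hD.ne']

/-- The crossing condition is `θ_{n+1}² + Q_{n+1}² x² = θ_n² + Q_n² x²`, linear in `x²`. It has
exactly one positive root because denominators increase and errors decrease. -/
theorem ConvergentSequence.smul_mem_unitHemisphere_iff {d : ℕ} {β : ℂ} {g : ℕ → SL(2, ℂ)}
    {b : ℕ → ℝ} (hg : ConvergentSequence d β g b) (n : ℕ) (s : ℝ) :
    g (n + 1) • modelGeodesic β s ∈ H3.unitHemisphere ↔
      s = -(1 / 2) * Real.log (crossingLevel β g n) := by
  have hpos := hg.crossingLevel_pos n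
  have hQ := hg.sq_lt_sq_denom n
  rw [Bianchi.smul_mem_unitHemisphere_iff, den_modelGeodesic, hg.row, hg.row, neg_mul, ← neg_add,
    norm_neg, norm_neg]
  change errNorm β g (n + 1) ^ 2 + denomNorm g (n + 1) ^ 2 * Real.exp (-s) ^ 2 =
    errNorm β g n ^ 2 + denomNorm g n ^ 2 * Real.exp (-s) ^ 2 ↔ _
  have h1 : errNorm β g (n + 1) ^ 2 + denomNorm g (n + 1) ^ 2 * Real.exp (-s) ^ 2 =
      errNorm β g n ^ 2 + denomNorm g n ^ 2 * Real.exp (-s) ^ 2 ↔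
      Real.exp (-s) ^ 2 = crossingLevel β g n := by
    unfold crossingLevel
    rw [eq_div_iff (by linarith)]
    constructor <;> intro h <;> linarith
  rw [h1]
  constructor
  · intro h
    rw [← h, Real.log_pow, Real.log_exp]
    push_cast
    ring
  · rintro rfl
    rw [← Real.exp_nat_mul]
    push_cast
    rw [show 2 * -(-(1 / 2) * Real.log (crossingLevel β g n)) = Real.log (crossingLevel β g n) by
      ring, Real.exp_log hpos]

theorem crossingLevel_le_exp {c s : ℝ} (hc : 0 < c) (hs : s ≤ -(1 / 2) * Real.log c) :
    c ≤ Real.exp (-s) ^ 2 := by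
  rw [← Real.exp_nat_mul, ← Real.log_le_iff_le_exp hc]
  push_cast
  linarith

theorem le_of_crossingLevel_le_exp {c s : ℝ} (hc : 0 < c) (hs : c ≤ Real.exp (-s) ^ 2) :
    s ≤ -(1 / 2) * Real.log c := by
  rw [← Real.exp_nat_mul, ← Real.log_le_iff_le_exp hc] at hs
  push_cast at hs
  linarith

/-- Norms are integers, so `Q_1 > 1` gives `Q_1² ≥ 2`. This means `t_1 ≥ 0`, so the time interval of
the maximum is nonempty. -/
theorem ConvergentSequence.crossingLevel_zero_le {d : ℕ} {β : ℂ} {g : ℕ → SL(2, ℂ)}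
    {b : ℕ → ℝ} (hg : ConvergentSequence d β g b) : crossingLevel β g 0 ≤ 1 := by
  have h1 := hg.sq_lt_sq_denom 0
  have h2 : (2 : ℝ) ≤ denomNorm g 1 ^ 2 := by
    obtain ⟨N, hN⟩ := exists_normSq_eq (apply_mem_ringO (hg.mem 1) 0 0)
    rw [Complex.normSq_eq_norm_sq] at hN
    change denomNorm g 1 ^ 2 = N at hN
    rw [zero_add, hN, hg.denom_zero] at h1
    rw [hN]
    have : 1 < N := by
      have h3 : (1 : ℝ) < N := by linarith
      exact_mod_cast h3
    exact_mod_cast this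
  have h3 := hg.err_le_one 0
  have h4 := hg.err_pos 0
  unfold crossingLevel
  rw [div_le_one (by linarith), hg.denom_zero, zero_add]
  nlinarith [sq_nonneg (errNorm β g 1)]

theorem ConvergentSequence.exists_expDist_ge {d : ℕ} {β : ℂ} {g : ℕ → SL(2, ℂ)}
    {b : ℕ → ℝ} (hg : ConvergentSequence d β g b) (n : ℕ) (hb : 5 / 2 ≤ b n) :
    ∃ s, 0 ≤ s ∧ crossingLevel β g n ≤ Real.exp (-s) ^ 2 ∧ 1 / 2 * b n - 1 ≤ expDist d β s := by
  have hθ := hg.err_pos n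
  have hθ1 := hg.err_le_one n
  have hQ := hg.one_le_denom n
  have hQ0 : 0 < denomNorm g n := by linarith
  have hx : 0 < errNorm β g n / denomNorm g n := div_pos hθ hQ0
  have hexp : Real.exp (- -Real.log (errNorm β g n / denomNorm g n)) =
      errNorm β g n / denomNorm g n := by rw [neg_neg, Real.exp_log hx]
  refine ⟨-Real.log (errNorm β g n / denomNorm g n), ?_, ?_, ?_⟩
  · have : Real.log (errNorm β g n / denomNorm g n) ≤ 0 :=
      Real.log_nonpos hx.le (by rw [div_le_one hQ0]; linarith)
    linarith
  · rw [hexp, div_pow]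
    unfold crossingLevel
    -- As `b n ≥ 5/2`, one has `Q_{n+1} ≥ (3/2) Q_n`, so the crossing level is at most `(θ_n /
    -- Q_n)²`: the peak at `x = θ_n / Q_n` is not later than the crossing.
    have h1 := hg.denom_succ n
    have h2 : 3 / 2 * denomNorm g n ≤ denomNorm g (n + 1) := by nlinarith
    have h3 : (3 / 2 * denomNorm g n) ^ 2 ≤ denomNorm g (n + 1) ^ 2 := by gcongr
    have h4 : denomNorm g n ^ 2 ≤ denomNorm g (n + 1) ^ 2 - denomNorm g n ^ 2 := by
      nlinarith [sq_nonneg (denomNorm g n)]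
    apply div_le_div₀ (by positivity) _ (by positivity) h4
    nlinarith [sq_nonneg (errNorm β g (n + 1))]
  · refine le_trans ?_ (r_le_expDist (hg.mem (n + 1)) β _)
    rw [r_smul_modelGeodesic, hexp, hg.row, hg.row, neg_mul, ← neg_add, norm_neg, norm_neg]
    change _ ≤ errNorm β g n / denomNorm g n / (errNorm β g n ^ 2 +
      denomNorm g n ^ 2 * (errNorm β g n / denomNorm g n) ^ 2)
    have h3 : errNorm β g n / denomNorm g n / (errNorm β g n ^ 2 +
      denomNorm g n ^ 2 * (errNorm β g n / denomNorm g n) ^ 2) =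
        1 / 2 * (1 / (denomNorm g n * errNorm β g n)) := by
      field_simp
      ring
    have h1 := (abs_le.mp (hg.peak n)).1
    rw [h3]
    linarith

/-! ### Nearest-integer expansions yield convergent sequences -/

theorem convergentSequence_liftMatrix {d : ℕ} (hd : d = 1 ∨ d = 2 ∨ d = 3 ∨ d = 7 ∨ d = 11)
    {ch : ℂ → ℂ} (hch : IsNearestInteger d ch) {β : ℂ} (hβ : β ∈ dirichletDomain d)
    (hirr : IsIrrational d β) :
    ConvergentSequence d β (liftMatrix ch β) (fun n => ‖digit ch β (n + 1)‖) := by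
  have inv : ∀ n, liftMatrix ch β n ∈ bianchiGroup d ∧
      ‖liftMatrix ch β n 0 0 * β + liftMatrix ch β n 0 1‖ ≤
        10 / 11 * ‖liftMatrix ch β n 1 0 * β + liftMatrix ch β n 1 1‖ ∧
      liftMatrix ch β n 0 0 ≠ 0 ∧ ‖liftMatrix ch β n 1 0‖ < ‖liftMatrix ch β n 0 0‖ := by
    intro n
    obtain ⟨g, hgn, hg, hY, hz, hc, hV, -⟩ := liftMatrix_invariant hd hch hβ hirr n
    rw [← hgn]
    refine ⟨hg, ?_, hc, ?_⟩
    · have h1 := norm_le_of_mem_closure hd (neg_one_pow_mul_mem_closure hz n)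
      rwa [hY, norm_div, div_le_iff₀ (norm_pos_iff.mpr (hirr.row_ne_zero hg 1))] at h1
    · rwa [norm_div, div_lt_one (norm_pos_iff.mpr hc)] at hV
  have htop : ∀ n j, liftMatrix ch β (n + 1) 0 j =
      -((-1) ^ n * digit ch β (n + 1)) * liftMatrix ch β n 0 j + liftMatrix ch β n 1 j :=
    fun n j => (matT_mul_matS_mul_apply _ _ j).1
  have hrow : ∀ n j, liftMatrix ch β (n + 1) 1 j = -liftMatrix ch β n 0 j :=
    fun n j => (matT_mul_matS_mul_apply _ _ j).2
  have hpos : ∀ n, 0 < errNorm β (liftMatrix ch β) n := fun n =>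
    norm_pos_iff.mpr (hirr.row_ne_zero (inv n).1 0)
  have hsucc : ∀ n, errNorm β (liftMatrix ch β) (n + 1) ≤
      10 / 11 * errNorm β (liftMatrix ch β) n := by
    intro n
    have := (inv (n + 1)).2.1
    rwa [hrow, hrow, neg_mul, ← neg_add, norm_neg] at this
  have hnorm : ∀ n, ‖(-1) ^ n * digit ch β (n + 1)‖ = ‖digit ch β (n + 1)‖ := by
    intro n; simp
  refine ⟨fun n => (inv n).1, rfl, hrow, norm_le_of_mem_closure hd (subset_closure hβ), hpos, hsucc,
    ?_, ?_, ?_⟩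
  · intro n
    have := (inv (n + 1)).2.2.2
    rwa [hrow, norm_neg] at this
  · intro n
    unfold denomNorm
    have h1 := norm_sub_norm_le (((-1) ^ n * digit ch β (n + 1)) * liftMatrix ch β n 0 0)
      (liftMatrix ch β n 1 0)
    rw [norm_mul, hnorm] at h1
    have h2 := (inv n).2.2.2
    rw [htop, show -((-1) ^ n * digit ch β (n + 1)) * liftMatrix ch β n 0 0 +
      liftMatrix ch β n 1 0 = -(((-1) ^ n * digit ch β (n + 1)) * liftMatrix ch β n 0 0 -
        liftMatrix ch β n 1 0) by ring, norm_neg]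
    linarith
  · intro n
    have hη := hirr.row_ne_zero (inv n).1 0
    have hc := (inv n).2.2.1
    have hV := (inv n).2.2.2
    have hdet := det_eq_one (liftMatrix ch β n)
    have hq := hsucc n
    have hn := hnorm n
    have e0 := htop n 0
    have e1 := htop n 1
    unfold denomNorm
    unfold errNorm at hq ⊢
    generalize (-1) ^ n * digit ch β (n + 1) = b at *
    generalize liftMatrix ch β (n + 1) = g' at *
    generalize liftMatrix ch β n = g at *
    obtain ⟨η, hηd⟩ : ∃ η, η = g 0 0 * β + g 0 1 := ⟨_, rfl⟩
    obtain ⟨η', hηd'⟩ : ∃ η, η = g' 0 0 * β + g' 0 1 := ⟨_, rfl⟩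
    rw [← hηd] at hη hq ⊢
    rw [← hηd'] at hq
    -- An exact form of "peak equals digit": both quotients on the right have modulus at most 1.
    have key : 1 / (g 0 0 * η) - b = η' / η - g 1 0 / g 0 0 := by
      rw [e0, e1] at hηd'
      field_simp
      rw [hηd', hηd]
      linear_combination -hdet
    rw [← hn, ← norm_mul, ← norm_one (α := ℂ), ← norm_div]
    refine (abs_norm_sub_norm_le _ _).trans ?_
    rw [key]
    refine (norm_sub_le _ _).trans ?_
    have h1 : ‖η' / η‖ ≤ 1 := by
      rw [norm_div, div_le_one (norm_pos_iff.mpr hη)]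
      linarith [norm_nonneg η]
    have h2 : ‖g 1 0 / g 0 0‖ ≤ 1 := by
      rw [norm_div, div_le_one (norm_pos_iff.mpr hc)]
      exact hV.le
    linarith [norm_one (α := ℂ)]

/-! ### Almost every point, and conclusion -/

theorem measurableSet_dirichletDomain (d : ℕ) : MeasurableSet (dirichletDomain d) := by
  have h : dirichletDomain d =
      ⋂ l ∈ (ringO d : Set ℂ), {z : ℂ | l ≠ 0 → ‖z‖ < ‖z - l‖} := by
    ext z
    simp [dirichletDomain]
  rw [h]
  refine MeasurableSet.biInter (countable_ringO d) fun l _ => ?_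
  by_cases hl : l = 0
  · simp [hl]
  · simp only [ne_eq, hl, not_false_eq_true, forall_const]
    exact measurableSet_lt continuous_norm.measurable
      (continuous_id.sub continuous_const).norm.measurable

theorem ae_isIrrational (d : ℕ) : ∀ᵐ β : ℂ, IsIrrational d β := by
  have hc : {β : ℂ | ¬ IsIrrational d β}.Countable := by
    refine (((countable_ringO d).prod (countable_ringO d)).image fun x => -x.2 / x.1).mono ?_
    intro β hβ
    change ¬ IsIrrational d β at hβ
    unfold IsIrrational at hβ
    push Not at hβ
    obtain ⟨q, hq, p, hp, hq0, h⟩ := hβ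
    refine ⟨(q, p), ⟨hq, hp⟩, ?_⟩
    change -p / q = β
    rw [div_eq_iff hq0]
    linear_combination -h
  filter_upwards [hc.ae_notMem MeasureTheory.volume] with β hβ
  simpa using hβ

end Bianchi

end

theorem mainTheorem6 (d : ℕ) (hd : d = 1 ∨ d = 2 ∨ d = 3 ∨ d = 7 ∨ d = 11)
    (ch : ℂ → ℂ) (hch : Bianchi.IsNearestInteger d ch) :
    ∀ᵐ β : ℂ ∂(MeasureTheory.volume.restrict (Bianchi.dirichletDomain d)),
      ∃ t : ℕ → ℝ, Bianchi.AreIntersectionTimes ch β t ∧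
        ∃ C : ℝ, ∀ n : ℕ, 1 ≤ n →
          ∃ M : ℝ,
            IsGreatest (Bianchi.expDist d β '' Set.Icc 0 (Bianchi.excursionTime t n)) M ∧
              |M - 1 / 2 * Bianchi.maxDigit ch β n| ≤ C := by
  filter_upwards [MeasureTheory.ae_restrict_mem (Bianchi.measurableSet_dirichletDomain d),
    MeasureTheory.ae_restrict_of_ae (Bianchi.ae_isIrrational d)] with β hβ hirr
  have hg := Bianchi.convergentSequence_liftMatrix hd hch hβ hirr
  obtain ⟨g, hgdef⟩ : ∃ g, g = Bianchi.liftMatrix ch β := ⟨_, rfl⟩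
  rw [← hgdef] at hg
  -- Only indices `n ≥ 1` matter; the truncated subtraction makes `t 0` a harmless copy of `t 1`.
  obtain ⟨t, ht⟩ : ∃ t : ℕ → ℝ,
      t = fun n => -(1 / 2) * Real.log (Bianchi.crossingLevel β g (n - 1)) := ⟨_, rfl⟩
  have htsucc : ∀ n, t (n + 1) = -(1 / 2) * Real.log (Bianchi.crossingLevel β g n) := by
    intro n; rw [ht]; rfl
  -- The constant is `612 + 25`, from `expDist_le` and `height_le`; it does not depend on `β`.
  refine ⟨t, ?_, 637, ?_⟩
  · intro n hn s
    obtain ⟨k, rfl⟩ : ∃ k, n = k + 1 := ⟨n - 1, by omega⟩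
    rw [Bianchi.liftedGeodesic_eq, ← hgdef, htsucc]
    exact hg.smul_mem_unitHemisphere_iff k s
  · intro n hn
    have hfin : (Set.Icc 1 n).Finite := Set.finite_Icc 1 n
    have hne : (Set.Icc 1 n).Nonempty := Set.nonempty_Icc.mpr hn
    have ht_le : ∀ k < n, t (k + 1) ≤ Bianchi.excursionTime t n := fun k hk =>
      le_csSup (hfin.image t).bddAbove ⟨k + 1, ⟨by omega, by omega⟩, rfl⟩
    obtain ⟨m, hm1, hm⟩ : Bianchi.excursionTime t n ∈ t '' Set.Icc 1 n :=
      (hne.image t).csSup_mem (hfin.image t)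
    obtain ⟨m, rfl⟩ : ∃ k, m = k + 1 := ⟨m - 1, by have := hm1.1; omega⟩
    obtain ⟨k, hk1, hk⟩ : Bianchi.maxDigit ch β n ∈
        (fun k => ‖Bianchi.digit ch β k‖) '' Set.Icc 1 n :=
      (hne.image _).csSup_mem (hfin.image _)
    obtain ⟨k, rfl⟩ : ∃ j, k = j + 1 := ⟨k - 1, by have := hk1.1; omega⟩
    have hB : ∀ j < n, ‖Bianchi.digit ch β (j + 1)‖ ≤ Bianchi.maxDigit ch β n := fun j hj =>
      le_csSup (hfin.image _).bddAbove ⟨j + 1, ⟨by omega, by omega⟩, rfl⟩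
    have hB0 : 0 ≤ Bianchi.maxDigit ch β n := hk ▸ norm_nonneg _
    have hT0 : 0 ≤ Bianchi.excursionTime t n := by
      refine le_trans ?_ (ht_le 0 (by omega))
      rw [htsucc]
      have := Real.log_nonpos (hg.crossingLevel_pos 0).le hg.crossingLevel_zero_le
      linarith
    obtain ⟨s, hs, hmax⟩ := Bianchi.exists_isGreatest_expDist d β hT0
    refine ⟨_, hmax, abs_le.mpr ⟨?_, ?_⟩⟩
    · have hge : 1 / 2 * Bianchi.maxDigit ch β n - 1 ≤ Bianchi.expDist d β s := by
        rcases le_or_gt (5 / 2) (Bianchi.maxDigit ch β n) with hb | hb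
        · rw [← hk] at hb ⊢
          obtain ⟨s', h0, h1, h2⟩ := hg.exists_expDist_ge k hb
          refine h2.trans (hmax.2 ⟨s', ⟨h0, ?_⟩, rfl⟩)
          refine le_trans ?_ (ht_le k hk1.2)
          rw [htsucc]
          exact Bianchi.le_of_crossingLevel_le_exp (hg.crossingLevel_pos k) h1
        -- For small digits the left-hand side is below `1/4`, and `e^d ≥ 1` suffices.
        · have := Bianchi.one_le_expDist d β s
          linarith
      linarith
    · obtain ⟨h, hh, hr⟩ := hg.exists_height_ge hs.1
      have h1 := Bianchi.expDist_le hd hch (hg.norm_le.trans (by norm_num)) hh hr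
      have h2 : Bianchi.crossingLevel β g m ≤ Real.exp (-s) ^ 2 :=
        Bianchi.crossingLevel_le_exp (hg.crossingLevel_pos m) (by rw [← htsucc, hm]; exact hs.2)
      have h3 := hg.height_le hh hs.1 hm1.2 h2 hB0 hB
      linarith
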